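/- Let $\mathscr D$ be the family of dyadic intervals $[2^{-k}p,2^{-k}(p+1))$, $k,p\in\mathbb Z$. For $I\in\mathscr D$ let $I_-,I_+$ be its left and right dyadic children, $\widehat I$ its dyadic parent, and $I^{(j)}\in\mathscr D$ its dyadic ancestor of length $2^j|I|$. For $I,J\in\mathscr D$ put $\operatorname{dist}_{\mathscr D}(I,J)=\min\{s+t:\ I^{(s)}=J^{(t)}\}$ (over integers $s,t\ge 0$), and $\operatorname{dist}_{\mathscr D}(I,J)=\infty$ if $I,J$ have no common ancestor. Let $\mu$ be a locally finite Borel measure on $\mathbb R$ without atoms, and put (with the convention $x/0=0$) $$m(I)=\frac{\mu(I_-)\mu(I_+)}{\mu(I)},\qquad h_I=\sqrt{m(I)}\left(\frac{1_{I_-}}{\mu(I_-)}-\frac{1_{I_+}}{\mu(I_+)}\right),\qquad \langle f\rangle_I=\frac1{\mu(I)}\int_I f\,d\mu,\qquad \langle f,g\rangle=\int_{\mathbb R} fg\,d\mu .$$ The measure $\mu$ is called balanced if there is a constant $c$ such that $m(I)\le c\,m(\widehat I)$ and $m(\widehat I)\le c\,m(I)$ for all $I\in\mathscr D$. For integers $s,t\ge0$,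 $\mathrm{HS}(s,t)$ is the family of the operators $T$ on the real space $L^2(\mu)$ of the form $$Tf=\sum_{I\in\mathscr D}\ \sum_{J\in\mathscr D:\,J^{(s)}=I}\ \sum_{K\in\mathscr D:\,K^{(t)}=I}\alpha^I_{J,K}\,\langle f,h_J\rangle\,h_K$$ (convergence in $L^2(\mu)$), with real coefficients $|\alpha^I_{J,K}|\le1$. A family $\mathcal S\subset\mathscr D$ is $\eta$-sparse if there are pairwise disjoint measurable sets $E_I\subset I$, $I\in\mathcal S$, with $\mu(E_I)\ge\eta\,\mu(I)$. For nonnegative $f_1,f_2$ put $$\mathcal A_{\mathcal S}(f_1,f_2)=\sum_{I\in\mathcal S}\langle f_1\rangle_I\langle f_2\rangle_I\,\mu(I),\qquad \mathcal C^N_{\mathcal S}(f_1,f_2)=\sum_{\substack{J,K\in\mathcal S,\ J\cap K=\emptyset\\ 2<\operatorname{dist}_{\mathscr D}(J,K)\le N+2}}\langle f_1\rangle_J\langle f_2\rangle_K\sqrt{m(J)}\sqrt{m(K)} .$$ **Theorem.** Let $\mu$ be balanced (and, as above, locally finite and atomless) and let $N\ge0$ be an integer. There are $\eta\in(0,1)$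 and $C<\infty$, depending only on $\mu$ and $N$, such that the following holds for all integers $s,t\ge0$ with $s+t\le N$ and all $T\in\mathrm{HS}(s,t)$: for all bounded, compactly supported, nonnegative $\mu$-measurable functions $f_1,f_2$ on $\mathbb R$ there is an $\eta$-sparse family $\mathcal S\subset\mathscr D$ with $$|\langle Tf_1,f_2\rangle|\le C\left(\mathcal A_{\mathcal S}(f_1,f_2)+\mathcal C^N_{\mathcal S}(f_1,f_2)\right).$$ -/

import Mathlib

open MeasureTheory Set
open scoped ENNReal NNReal

noncomputable section

namespace BalancedSparse

/-- The dyadic interval `[2⁻ᵏ p, 2⁻ᵏ (p + 1))`, encoded by its scale `k` and its position `p`.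
Distinct pairs `(k, p)` give distinct intervals, so this type is the standard dyadic grid of `ℝ`. -/
@[ext]
structure DyadicInterval where
  k : ℤ
  p : ℤ

namespace DyadicInterval

/-- The underlying half-open interval. -/
def toSet (I : DyadicInterval) : Set ℝ :=
  Ico ((2 : ℝ) ^ (-I.k) * I.p) ((2 : ℝ) ^ (-I.k) * (I.p + 1))

/-- The left dyadic child `I₋`. -/
def left (I : DyadicInterval) : DyadicInterval := ⟨I.k + 1, 2 * I.p⟩

/-- The right dyadic child `I₊`. -/
def right (I : DyadicInterval) : DyadicInterval := ⟨I.k + 1, 2 * I.p + 1⟩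

/-- The dyadic parent: the dyadic interval of twice the length that contains `I`
(division of integers rounds down here). -/
def parent (I : DyadicInterval) : DyadicInterval := ⟨I.k - 1, I.p / 2⟩

/-- The dyadic ancestor `I⁽ʲ⁾`: the dyadic interval of length `2ʲ ℓ(I)` that contains `I`. -/
def ancestor (j : ℕ) (I : DyadicInterval) : DyadicInterval := parent^[j] I

/-- The dyadic distance: the minimum of `s + t` over all `(s, t)` with `I⁽ˢ⁾ = J⁽ᵗ⁾`,
and `∞` if `I` and `J` have no common ancestor. -/
def dyadicDist (I J : DyadicInterval) : ℕ∞ :=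
  ⨅ (s : ℕ) (t : ℕ) (_ : ancestor s I = ancestor t J), ((s + t : ℕ) : ℕ∞)

end DyadicInterval

open DyadicInterval

/-- `m(I) = μ(I₋) μ(I₊) / μ(I)` (with `0 / 0 = 0`). -/
def m (μ : Measure ℝ) (I : DyadicInterval) : ℝ :=
  μ.real I.left.toSet * μ.real I.right.toSet / μ.real I.toSet

/-- `m(I) ∼ m(Î)` uniformly over all dyadic intervals `I`, where `Î` is the parent of `I`. -/
def IsBalanced (μ : Measure ℝ) : Prop :=
  ∃ c : ℝ, ∀ I : DyadicInterval, m μ I ≤ c * m μ I.parent ∧ m μ I.parent ≤ c * m μ I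

/-- The average of `f` over `I` with respect to `μ` (zero if `μ(I) = 0`). -/
def avg (μ : Measure ℝ) (f : ℝ → ℝ) (I : DyadicInterval) : ℝ :=
  (μ.real I.toSet)⁻¹ * ∫ x in I.toSet, f x ∂μ

/-- The bilinear pairing `∫ f g dμ`. -/
def pairing (μ : Measure ℝ) (f g : ℝ → ℝ) : ℝ := ∫ x, f x * g x ∂μ

/-- The Haar function `h_I` with respect to `μ`. -/
def haar (μ : Measure ℝ) (I : DyadicInterval) (x : ℝ) : ℝ :=
  √(m μ I) * (I.left.toSet.indicator (fun _ => (μ.real I.left.toSet)⁻¹) x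
    - I.right.toSet.indicator (fun _ => (μ.real I.right.toSet)⁻¹) x)

theorem memLp_haar (μ : Measure ℝ) [IsLocallyFiniteMeasure μ] (I : DyadicInterval) :
    MemLp (haar μ I) 2 μ := by
  refine MemLp.const_mul (MemLp.sub ?_ ?_) _ <;>
  exact memLp_indicator_const 2 measurableSet_Ico _ (Or.inr measure_Ico_lt_top.ne)

/-- The Haar function `h_I` as an element of `L²(μ)`. -/
def haarL2 (μ : Measure ℝ) [IsLocallyFiniteMeasure μ] (I : DyadicInterval) : Lp ℝ 2 μ :=
  (memLp_haar μ I).toLp (haar μ I)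

/-- The triples `(I, J, K)` of dyadic intervals with `J⁽ˢ⁾ = I` and `K⁽ᵗ⁾ = I`. -/
abbrev ShiftIndex (s t : ℕ) : Type :=
  {q : DyadicInterval × DyadicInterval × DyadicInterval //
    ancestor s q.2.1 = q.1 ∧ ancestor t q.2.2 = q.1}

/-- The family of Haar shifts of complexity `(s, t)`: the operators `T` on `L²(μ)` with
`T f = ∑_I ∑_{J⁽ˢ⁾ = I} ∑_{K⁽ᵗ⁾ = I} α_{J,K}^I ⟨f, h_J⟩ h_K`, the sum converging
in `L²(μ)`, for some coefficients `α` bounded by one in absolute value. -/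
def HS (μ : Measure ℝ) [IsLocallyFiniteMeasure μ] (s t : ℕ) : Set (Lp ℝ 2 μ → Lp ℝ 2 μ) :=
  {T | ∃ α : DyadicInterval → DyadicInterval → DyadicInterval → ℝ,
    (∀ I J K, |α I J K| ≤ 1) ∧
    ∀ f : Lp ℝ 2 μ,
      HasSum (fun q : ShiftIndex s t =>
        (α q.1.1 q.1.2.1 q.1.2.2 * pairing μ f (haar μ q.1.2.1)) • haarL2 μ q.1.2.2) (T f)}

/-- `S` is `η`-sparse with respect to `μ`. -/
def IsSparse (μ : Measure ℝ) (η : ℝ) (S : Set DyadicInterval) : Prop :=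
  ∃ E : DyadicInterval → Set ℝ,
    (∀ I ∈ S, MeasurableSet (E I) ∧ E I ⊆ I.toSet ∧ ENNReal.ofReal η * μ I.toSet ≤ μ (E I)) ∧
    ∀ I ∈ S, ∀ I' ∈ S, I ≠ I' → Disjoint (E I) (E I')

/-- The sparse form `𝒜_S(f₁, f₂)`, for nonnegative functions; a sum in `[0, ∞]`. -/
def sparseForm (μ : Measure ℝ) (S : Set DyadicInterval) (f₁ f₂ : ℝ → ℝ) : ℝ≥0∞ :=
  ∑' I : S, ENNReal.ofReal (avg μ f₁ I * avg μ f₂ I * μ.real I.1.toSet)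

/-- The modified sparse form `𝒞_S^N(f₁, f₂)`, for nonnegative functions; a sum in `[0, ∞]` over
the pairs of disjoint intervals of `S` at dyadic distance greater than `2` and at most `N + 2`. -/
def modifiedForm (μ : Measure ℝ) (N : ℕ) (S : Set DyadicInterval) (f₁ f₂ : ℝ → ℝ) : ℝ≥0∞ :=
  ∑' q : {q : DyadicInterval × DyadicInterval // q.1 ∈ S ∧ q.2 ∈ S ∧
      2 < dyadicDist q.1 q.2 ∧ dyadicDist q.1 q.2 ≤ ((N + 2 : ℕ) : ℕ∞) ∧ Disjoint q.1.toSet q.2.toSet},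
    ENNReal.ofReal (avg μ f₁ q.1.1 * avg μ f₂ q.1.2 * √(m μ q.1.1) * √(m μ q.1.2))

/-- Bounded, compactly supported, nonnegative (and `μ`-measurable) functions. -/
structure IsAdmissible (μ : Measure ℝ) (f : ℝ → ℝ) : Prop where
  aestronglyMeasurable : AEStronglyMeasurable f μ
  hasCompactSupport : HasCompactSupport f
  bounded : ∃ M : ℝ, ∀ x, f x ≤ M
  nonneg : ∀ x, 0 ≤ f x

theorem IsAdmissible.memLp {μ : Measure ℝ} [IsLocallyFiniteMeasure μ] {f : ℝ → ℝ}
    (hf : IsAdmissible μ f) : MemLp f 2 μ := by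
  obtain ⟨M, hM⟩ := hf.bounded
  refine hf.hasCompactSupport.memLp_of_bound hf.aestronglyMeasurable M (ae_of_all _ fun x => ?_)
  rw [Real.norm_of_nonneg (hf.nonneg x)]
  exact hM x

/-- The class in `L²(μ)` of an admissible function. -/
def IsAdmissible.toL2 {μ : Measure ℝ} [IsLocallyFiniteMeasure μ] {f : ℝ → ℝ}
    (hf : IsAdmissible μ f) : Lp ℝ 2 μ := hf.memLp.toLp f

end BalancedSparse

end

open BalancedSparse

/-!
The bilinear form of a Haar shift is a series of products `α ⟨f₁, h_J⟩ ⟨f₂, h_K⟩`, where `J` and `K`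
have a common ancestor `I` a bounded number of generations above. Some finite part of the series
carries at least half of the sum, and the sparse family may depend on this part. So the stopping
time may start at the scale `k₀` of the longest interval `I` that occurs, and only absolute values
of the summands are needed.

The sparse family `stopSet` consists of the intervals of scale `k₀` together with, below each
member `P`, the maximal intervals on which the average of `f₁` or `f₂` is more than four times the
average on `P`. The new intervals cover at most half of `P`, so the family is sparse
(`isSparse_stopSet`). Write `host X` for the smallest member containing `X`; the averages over `X`
are at most four times those over `host X`.

As `⟨f, h_J⟩` is `√m(J)` times the difference of the averages over the children of `J`, it splits
into a good part, coming from the children that are not in the family, and a bad part. The product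
of two coefficients is then at most the product of the good parts, present only if
`host J = host K`, plus contributions of pairs of children `(X, Y)` for which `host X ≠ host Y` or
one of `X`, `Y` is in the family (`abs_pairing_mul_pairing_le`).

* The good parts are square summable over `host J = S`, with sum at most a constant times
  `⟨f⟩_S² μ(S)` (`tsum_goodCoeff_sq_le`). As `μ` need not be doubling, averages over stopping
  intervals are not controlled. The proof telescopes `μ(J) ⟨f⟩_J²` down the tree, the drop caused by
  discarding a stopping child being paid for by the mass of `f` in that child (`energy_step`). The
  inequality of arithmetic and geometric means turns this into the sparse form.
* For the remaining pairs, with `P = host X` and `R = host Y`, balance makes `√m(J) √m(K)`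
  comparable to `m` of every interval nearby (`exists_target`). If `P = R`, the pair is charged to
  the term of `P` in the sparse form. If `P ⊊ R`, there is a maximal member `Q ⊊ R` that contains
  `P`, and the bound is the integral of `f₁` over `Q` times the average of `f₂` over `R`; the
  intervals `Q` are disjoint, so these sum to the sparse form. If `P` and `R` are disjoint, the
  bound is a term of the modified form, unless `P` and `R` are siblings; then
  `m(I) ⟨f₁⟩_P ⟨f₂⟩_R`, with `I` their parent, is at most `⟨f₁⟩_I` times the integral of `f₂`
  over `R`.

In each case the target lies a bounded number of generations below `I`, so no target is charged
more than a bounded number of times (`sum_le_mul_tsum_of_charge`).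
-/

namespace BalancedSparse

open DyadicInterval

/-! ### The dyadic tree -/

namespace DyadicInterval

@[simp] theorem parent_left (I : DyadicInterval) : I.left.parent = I := by
  ext <;> simp [left, parent]

@[simp] theorem parent_right (I : DyadicInterval) : I.right.parent = I := by
  ext
  · simp [right, parent]
  · simp only [right, parent]; omega

theorem eq_left_or_right_parent (I : DyadicInterval) :
    I = I.parent.left ∨ I = I.parent.right := by
  rcases Int.emod_two_eq_zero_or_one I.p with h | h
  · left; ext
    · simp [left, parent]
    · simp only [left, parent]; omega
  · right; ext
    · simp [right, parent]
    · simp only [right, parent]; omega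

@[simp] theorem ancestor_zero (I : DyadicInterval) : ancestor 0 I = I := rfl

theorem ancestor_succ (j : ℕ) (I : DyadicInterval) :
    ancestor (j + 1) I = ancestor j I.parent := rfl

theorem ancestor_succ' (j : ℕ) (I : DyadicInterval) :
    ancestor (j + 1) I = (ancestor j I).parent :=
  Function.iterate_succ_apply' _ _ _

theorem ancestor_add (i j : ℕ) (I : DyadicInterval) :
    ancestor (i + j) I = ancestor i (ancestor j I) :=
  Function.iterate_add_apply _ _ _ _

@[simp] theorem ancestor_k (j : ℕ) (I : DyadicInterval) : (ancestor j I).k = I.k - j := by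
  induction j generalizing I with
  | zero => simp
  | succ j ih => rw [ancestor_succ, ih]; simp only [parent]; push_cast; ring

/-- If `P` and `R` are ancestors of `X` and `R` is at least as long as `P`, then `R` is an
ancestor of `P`. -/
theorem ancestor_of_ancestor {X P R : DyadicInterval} {i j : ℕ} (hP : ancestor i X = P)
    (hR : ancestor j X = R) (h : R.k ≤ P.k) : i ≤ j ∧ ancestor (j - i) P = R := by
  have h1 : P.k = X.k - i := by rw [← hP, ancestor_k]
  have h2 : R.k = X.k - j := by rw [← hR, ancestor_k]
  have hij : i ≤ j := by omega
  refine ⟨hij, ?_⟩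
  rw [← hP, ← ancestor_add, Nat.sub_add_cancel hij, hR]

theorem toSet_eq_union (I : DyadicInterval) : I.toSet = I.left.toSet ∪ I.right.toSet := by
  have h : (2 : ℝ) ^ (-(I.k + 1)) = 2 ^ (-I.k) / 2 := by
    rw [neg_add, zpow_add₀ two_ne_zero, zpow_neg_one, div_eq_mul_inv]
  have h0 : (0 : ℝ) < 2 ^ (-I.k) := by positivity
  simp only [toSet, left, right, h]
  push_cast
  rw [Ico_union_Ico_eq_Ico (by nlinarith) (by nlinarith)]
  congr 1 <;> ring

theorem disjoint_left_right (I : DyadicInterval) : Disjoint I.left.toSet I.right.toSet := by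
  simp only [toSet, left, right]
  push_cast
  exact Ico_disjoint_Ico_same

theorem measurableSet_toSet (I : DyadicInterval) : MeasurableSet I.toSet := measurableSet_Ico

theorem toSet_subset_parent (I : DyadicInterval) : I.toSet ⊆ I.parent.toSet := by
  rw [toSet_eq_union I.parent]
  rcases eq_left_or_right_parent I with h | h <;> rw [← h]
  exacts [subset_union_left, subset_union_right]

theorem toSet_subset_ancestor (j : ℕ) (I : DyadicInterval) : I.toSet ⊆ (ancestor j I).toSet := by
  induction j generalizing I with
  | zero => simp
  | succ j ih => exact (toSet_subset_parent I).trans (ih _)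

theorem eq_of_mem_toSet {I J : DyadicInterval} {x : ℝ} (hI : x ∈ I.toSet) (hJ : x ∈ J.toSet)
    (h : I.k = J.k) : I = J := by
  have key : ∀ K : DyadicInterval, x ∈ K.toSet → ⌊x * (2 : ℝ) ^ K.k⌋ = K.p := by
    intro K hK
    have h0 : (0 : ℝ) < 2 ^ K.k := by positivity
    have h1 : (2 : ℝ) ^ (-K.k) * 2 ^ K.k = 1 := by rw [zpow_neg]; exact inv_mul_cancel₀ h0.ne'
    obtain ⟨h2, h3⟩ := hK
    rw [Int.floor_eq_iff]
    constructor
    · have := mul_le_mul_of_nonneg_right h2 h0.le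
      linear_combination this - K.p * h1
    · have := mul_lt_mul_of_pos_right h3 h0
      linear_combination this + (K.p + 1) * h1
  ext
  · exact h
  · rw [← key I hI, ← key J hJ, h]

/-- Dyadic intervals that meet are nested. -/
theorem ancestor_of_mem_toSet {I J : DyadicInterval} {x : ℝ} (hI : x ∈ I.toSet)
    (hJ : x ∈ J.toSet) (h : I.k ≤ J.k) : ∃ j, ancestor j J = I := by
  refine ⟨(J.k - I.k).toNat, eq_of_mem_toSet (toSet_subset_ancestor _ _ hJ) hI ?_⟩
  rw [ancestor_k]; omega

open Classical in
/-- The descendants of `I` of generation `j`. -/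
noncomputable def descendants : ℕ → DyadicInterval → Finset DyadicInterval
  | 0, I => {I}
  | j + 1, I => descendants j I.left ∪ descendants j I.right

open Classical in
theorem card_descendants_le (j : ℕ) (I : DyadicInterval) : (descendants j I).card ≤ 2 ^ j := by
  induction j generalizing I with
  | zero => simp [descendants]
  | succ j ih =>
    refine (Finset.card_union_le _ _).trans ?_
    have h1 := ih I.left
    have h2 := ih I.right
    rw [pow_succ]; omega

open Classical in
theorem mem_descendants_ancestor (j : ℕ) (J : DyadicInterval) :
    J ∈ descendants j (ancestor j J) := by
  have key : ∀ (j : ℕ) (I J : DyadicInterval), ancestor j J = I → J ∈ descendants j I := by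
    intro j
    induction j with
    | zero => intro I J h; simpa [descendants] using h
    | succ j ih =>
      intro I J h
      rw [ancestor_succ'] at h
      rw [descendants, Finset.mem_union]
      rcases eq_left_or_right_parent (ancestor j J) with h' | h'
      · exact Or.inl (ih _ _ (by rw [h', h]))
      · exact Or.inr (ih _ _ (by rw [h', h]))
  exact key j _ J rfl

end DyadicInterval

/-- A superadditive potential `ψ` that pays for the weight `w` at every node of the dyadic tree
below `S` dominates the total weight. -/
theorem tsum_le_of_potential (S : DyadicInterval) (w ψ : DyadicInterval → ℝ≥0∞)
    (hw : ∀ J, w J ≠ 0 → ∃ j, ancestor j J = S)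
    (h : ∀ J, (∃ j, ancestor j J = S) → w J + (ψ J.left + ψ J.right) ≤ ψ J) :
    ∑' J, w J ≤ ψ S := by
  classical
  -- the descendants of generation `< n`
  let D : ℕ → DyadicInterval → Finset DyadicInterval := fun n =>
    Nat.rec (fun _ => ∅) (fun _ D I => {I} ∪ (D I.left ∪ D I.right)) n
  have hD : ∀ n I, D (n + 1) I = {I} ∪ (D n I.left ∪ D n I.right) := fun _ _ => rfl
  have sum_union_le : ∀ A B : Finset DyadicInterval,
      ∑ J ∈ A ∪ B, w J ≤ ∑ J ∈ A, w J + ∑ J ∈ B, w J := by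
    intro A B
    rw [← Finset.sum_union_inter]
    exact le_self_add
  have hle : ∀ n I, (∃ j, ancestor j I = S) → ∑ J ∈ D n I, w J ≤ ψ I := by
    intro n
    induction n with
    | zero => intro I _; simp [D]
    | succ n ih =>
      intro I hI
      have hl : ∃ j, ancestor j I.left = S := by
        obtain ⟨j, hj⟩ := hI
        exact ⟨j + 1, by rw [ancestor_succ, parent_left, hj]⟩
      have hr : ∃ j, ancestor j I.right = S := by
        obtain ⟨j, hj⟩ := hI
        exact ⟨j + 1, by rw [ancestor_succ, parent_right, hj]⟩
      rw [hD]
      refine (sum_union_le _ _).trans ((add_le_add ?_ ((sum_union_le _ _).trans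
        (add_le_add (ih _ hl) (ih _ hr)))).trans (h I hI))
      simp
  have hmono : ∀ n I, D n I ⊆ D (n + 1) I := by
    intro n
    induction n with
    | zero => intro I; simp [D]
    | succ n ih =>
      intro I
      rw [hD, hD (n + 1)]
      exact Finset.union_subset_union_right (Finset.union_subset_union (ih _) (ih _))
  have hmem : ∀ j I J, ancestor j J = I → J ∈ D (j + 1) I := by
    intro j
    induction j with
    | zero => intro I J h; simp [hD, show J = I from h]
    | succ j ih =>
      intro I J h
      rw [ancestor_succ'] at h
      refine (hD (j + 1) I).symm ▸ Finset.mem_union_right _ (Finset.mem_union.2 ?_)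
      rcases eq_left_or_right_parent (ancestor j J) with h' | h'
      · exact Or.inl (ih _ _ (by rw [h', h]))
      · exact Or.inr (ih _ _ (by rw [h', h]))
  rw [ENNReal.tsum_eq_iSup_sum]
  refine iSup_le fun F => ?_
  have hF : ∃ n, ∀ J ∈ F, w J ≠ 0 → J ∈ D n S := by
    induction F using Finset.induction_on with
    | empty => exact ⟨0, by simp⟩
    | insert J F _ ih =>
      obtain ⟨n, hn⟩ := ih
      by_cases hJ : w J = 0
      · exact ⟨n, by simp only [Finset.mem_insert]; rintro J' (rfl | h') h0
                     exacts [absurd hJ h0, hn _ h' h0]⟩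
      · obtain ⟨j, hj⟩ := hw J hJ
        have hm : Monotone fun n => D n S := monotone_nat_of_le_succ fun n => hmono n S
        refine ⟨max n (j + 1), ?_⟩
        simp only [Finset.mem_insert]
        rintro J' (rfl | h') h0
        · exact hm (le_max_right _ _) (hmem j S _ hj)
        · exact hm (le_max_left _ _) (hn _ h' h0)
  obtain ⟨n, hn⟩ := hF
  calc ∑ J ∈ F, w J = ∑ J ∈ F.filter (fun J => w J ≠ 0), w J := (Finset.sum_filter_ne_zero F).symm
    _ ≤ ∑ J ∈ D n S, w J := Finset.sum_le_sum_of_subset fun J hJ => by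
        rw [Finset.mem_filter] at hJ; exact hn J hJ.1 hJ.2
    _ ≤ ψ S := hle n S ⟨0, rfl⟩

/-- A sum over a finite set is controlled by a sum of targets if every summand can be charged to
a target and no target is charged more than `B` times. -/
theorem sum_le_mul_tsum_of_charge {X Y : Type*} (G : Finset X) (u : X → ℝ≥0∞) (v : Y → ℝ≥0∞)
    (r : X → Y → Prop) (B : ℕ) (hB : ∀ y, ∃ F : Finset X, F.card ≤ B ∧ ∀ x ∈ G, r x y → x ∈ F)
    (h : ∀ x ∈ G, ∃ y, r x y ∧ u x ≤ v y) : ∑ x ∈ G, u x ≤ B * ∑' y, v y := by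
  classical
  calc ∑ x ∈ G, u x ≤ ∑ x ∈ G, ∑' y, if r x y then v y else 0 := by
        refine Finset.sum_le_sum fun x hx => ?_
        obtain ⟨y, hy, hxy⟩ := h x hx
        refine hxy.trans (le_trans ?_ (ENNReal.le_tsum y))
        rw [if_pos hy]
    _ = ∑' y, ∑ x ∈ G, if r x y then v y else 0 :=
        (Summable.tsum_finsetSum fun _ _ => ENNReal.summable).symm
    _ ≤ ∑' y, B * v y := by
        refine ENNReal.tsum_le_tsum fun y => ?_
        obtain ⟨F, hF, hGF⟩ := hB y
        rw [← Finset.sum_filter, Finset.sum_const, nsmul_eq_mul]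
        gcongr
        refine (Finset.card_le_card fun x hx => ?_).trans hF
        rw [Finset.mem_filter] at hx
        exact hGF x hx.1 hx.2
    _ = B * ∑' y, v y := ENNReal.tsum_mul_left

/-! ### Stopping intervals -/

section Stopping

variable (c : DyadicInterval → DyadicInterval → Prop) (k₀ : ℤ)

open Classical in
/-- The stopping ancestor of an interval at depth `n` below the top scale: the interval itself if
it satisfies the stopping condition `c` relative to the stopping ancestor of its parent, and
otherwise the stopping ancestor of its parent. -/
noncomputable def hostAux : ℕ → DyadicInterval → DyadicInterval
  | 0, I => I
  | n + 1, I => if c I (hostAux n I.parent) then I else hostAux n I.parent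

/-- The stopping ancestor of `I` in the tree whose top intervals are those of scale `k₀`: the
smallest stopping interval containing `I`. Intervals longer than the top ones are their own
stopping ancestors, a junk value. -/
noncomputable def host (I : DyadicInterval) : DyadicInterval := hostAux c (I.k - k₀).toNat I

/-- The stopping intervals, that is, the intervals of scale at least `k₀` that are their own
stopping ancestor. -/
def stopSet : Set DyadicInterval := {I | k₀ ≤ I.k ∧ host c k₀ I = I}

/-- `Q` is a maximal stopping interval strictly inside the stopping interval `R`. -/
def IsStopChild (Q R : DyadicInterval) : Prop :=
  k₀ < Q.k ∧ host c k₀ Q = Q ∧ host c k₀ Q.parent = R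

variable {c k₀}

theorem host_of_le {I : DyadicInterval} (h : I.k ≤ k₀) : host c k₀ I = I := by
  rw [host, Int.toNat_of_nonpos (by omega)]; rfl

open Classical in
theorem host_eq_ite {I : DyadicInterval} (h : k₀ < I.k) :
    host c k₀ I = if c I (host c k₀ I.parent) then I else host c k₀ I.parent := by
  have h1 : (I.k - k₀).toNat = (I.parent.k - k₀).toNat + 1 := by simp only [parent]; omega
  rw [host, h1]; rfl

/-- Induction on the depth below the top scale `k₀`. -/
theorem scale_induction {p : DyadicInterval → Prop} (top : ∀ I, I.k = k₀ → p I)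
    (step : ∀ I, k₀ < I.k → p I.parent → p I) (I : DyadicInterval) (h : k₀ ≤ I.k) : p I := by
  obtain ⟨n, hn⟩ := Int.le.dest h
  induction n generalizing I with
  | zero => exact top I (by simpa using hn.symm)
  | succ n ih =>
    have : I.parent.k = I.k - 1 := rfl
    exact step I (by omega) (ih _ (by omega) (by omega))

theorem host_eq_or {I : DyadicInterval} (h : k₀ < I.k) :
    host c k₀ I = I ∨ host c k₀ I = host c k₀ I.parent ∧ ¬ c I (host c k₀ I.parent) := by
  classical
  rw [host_eq_ite h]
  split_ifs with h'
  · exact Or.inl rfl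
  · exact Or.inr ⟨rfl, h'⟩

theorem host_spec (I : DyadicInterval) (h : k₀ ≤ I.k) :
    (∃ j, ancestor j I = host c k₀ I) ∧ host c k₀ I ∈ stopSet c k₀ := by
  revert I
  apply scale_induction
  · intro I hI
    rw [host_of_le hI.le]
    exact ⟨⟨0, rfl⟩, hI.ge, host_of_le hI.le⟩
  · rintro I hI ⟨⟨j, hj⟩, hmem⟩
    rcases host_eq_or (c := c) hI with h | ⟨h, -⟩
    · rw [h]; exact ⟨⟨0, rfl⟩, hI.le, h⟩
    · rw [h]; exact ⟨⟨j + 1, hj⟩, hmem⟩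

theorem exists_ancestor_eq_host {I : DyadicInterval} (h : k₀ ≤ I.k) :
    ∃ j, ancestor j I = host c k₀ I := (host_spec I h).1

theorem host_mem {I : DyadicInterval} (h : k₀ ≤ I.k) : host c k₀ I ∈ stopSet c k₀ :=
  (host_spec I h).2

/-- The stopping ancestor is the smallest stopping interval containing a given interval. -/
theorem host_minimal {I P : DyadicInterval} (hP : P ∈ stopSet c k₀) {j : ℕ}
    (h : ancestor j I = P) : ∃ i, ancestor i (host c k₀ I) = P := by
  induction j generalizing I with
  | zero =>
    rw [ancestor_zero] at h
    subst h
    exact ⟨0, hP.2⟩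
  | succ j ih =>
    have hk : k₀ < I.k := by
      have h1 := hP.1
      rw [← h, ancestor_k] at h1
      push_cast at h1
      omega
    rcases host_eq_or (c := c) hk with h' | ⟨h', -⟩
    · rw [h']; exact ⟨j + 1, h⟩
    · rw [h']; exact ih h

theorem IsStopChild.mem {Q R : DyadicInterval} (h : IsStopChild c k₀ Q R) : Q ∈ stopSet c k₀ :=
  ⟨h.1.le, h.2.1⟩

theorem IsStopChild.mem_right {Q R : DyadicInterval} (h : IsStopChild c k₀ Q R) :
    R ∈ stopSet c k₀ := by
  rw [← h.2.2]
  refine host_mem ?_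
  have := h.1
  simp only [parent]; omega

theorem IsStopChild.exists_ancestor {Q R : DyadicInterval} (h : IsStopChild c k₀ Q R) :
    ∃ j, ancestor (j + 1) Q = R := by
  have h1 : k₀ ≤ Q.parent.k := by have := h.1; simp only [parent]; omega
  obtain ⟨j, hj⟩ := exists_ancestor_eq_host (c := c) h1
  exact ⟨j, by rw [ancestor_succ, hj, h.2.2]⟩

theorem IsStopChild.cond {Q R : DyadicInterval} (h : IsStopChild c k₀ Q R) : c Q R := by
  classical
  obtain ⟨j, hj⟩ := h.exists_ancestor
  have h1 := host_eq_ite (c := c) h.1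
  rw [h.2.2, h.2.1] at h1
  by_contra hc
  rw [if_neg hc] at h1
  have h2 := congrArg DyadicInterval.k hj
  rw [ancestor_k, ← h1] at h2
  push_cast at h2
  omega

/-- Between two nested stopping intervals `P ⊊ R` there is a stopping child of `R`. -/
theorem exists_isStopChild {P R : DyadicInterval} (hP : P ∈ stopSet c k₀)
    (hR : R ∈ stopSet c k₀) {j : ℕ} (h : ancestor (j + 1) P = R) :
    ∃ Q i, ancestor i P = Q ∧ IsStopChild c k₀ Q R := by
  induction j using Nat.strong_induction_on generalizing P with
  | _ j ih =>
    have hk : R.k = P.k - (j + 1) := by rw [← h, ancestor_k]; push_cast; ring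
    have hRk := hR.1
    have hk' : k₀ ≤ P.parent.k := by simp only [parent]; omega
    obtain ⟨i, hi⟩ := host_minimal hR (I := P.parent) (j := j) h
    obtain ⟨l, hl⟩ := exists_ancestor_eq_host (c := c) hk'
    have hl' : (host c k₀ P.parent).k = P.k - 1 - l := by rw [← hl, ancestor_k]; rfl
    have hi' : R.k = (host c k₀ P.parent).k - i := by rw [← hi, ancestor_k]
    cases i with
    | zero => exact ⟨P, 0, rfl, by omega, hP.2, hi⟩
    | succ i =>
      obtain ⟨Q, n, hn, hQ⟩ := ih i (by push_cast at hi'; omega) (host_mem hk') hi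
      exact ⟨Q, n + (l + 1), by rw [ancestor_add, ancestor_succ, hl, hn], hQ⟩

end Stopping

/-! ### Masses, averages and Haar coefficients -/

/-- The integral of `f` over `I`. -/
noncomputable def mass (μ : Measure ℝ) (f : ℝ → ℝ) (I : DyadicInterval) : ℝ :=
  ∫ x in I.toSet, f x ∂μ

section Averages

variable {μ : Measure ℝ} {f : ℝ → ℝ}

theorem mass_nonneg (hf : IsAdmissible μ f) (I : DyadicInterval) : 0 ≤ mass μ f I :=
  integral_nonneg hf.nonneg

theorem avg_eq (I : DyadicInterval) : avg μ f I = (μ.real I.toSet)⁻¹ * mass μ f I := rfl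

theorem avg_nonneg (hf : IsAdmissible μ f) (I : DyadicInterval) : 0 ≤ avg μ f I :=
  mul_nonneg (inv_nonneg.2 measureReal_nonneg) (mass_nonneg hf I)

theorem m_nonneg (I : DyadicInterval) : 0 ≤ m μ I := by
  unfold m; positivity

/-- `X` is a descendant of `I` of generation at most `n`. -/
def Near (n : ℕ) (X I : DyadicInterval) : Prop := ∃ i ≤ n, ancestor i X = I

/-- For a balanced measure, `m` is comparable along bounded chains of ancestors. -/
theorem IsBalanced.exists_m_le (hμ : IsBalanced μ) (n : ℕ) :
    ∃ κ : ℝ, 1 ≤ κ ∧ ∀ I X Y : DyadicInterval, Near n X I → Near n Y I → m μ X ≤ κ * m μ Y := by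
  obtain ⟨c, hc⟩ := hμ
  set d := max c 1 with hd
  have hd1 : 1 ≤ d := le_max_right _ _
  have h1 : ∀ I, m μ I ≤ d * m μ I.parent := fun I =>
    (hc I).1.trans (mul_le_mul_of_nonneg_right (le_max_left _ _) (m_nonneg _))
  have h2 : ∀ I, m μ I.parent ≤ d * m μ I := fun I =>
    (hc I).2.trans (mul_le_mul_of_nonneg_right (le_max_left _ _) (m_nonneg _))
  have up : ∀ (j : ℕ) I, m μ I ≤ d ^ j * m μ (ancestor j I) ∧
      m μ (ancestor j I) ≤ d ^ j * m μ I := by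
    intro j
    induction j with
    | zero => simp
    | succ j ih =>
      intro I
      have hp : 0 ≤ d ^ j := by positivity
      rw [ancestor_succ, pow_succ]
      obtain ⟨ih1, ih2⟩ := ih I.parent
      constructor
      · calc m μ I ≤ d * m μ I.parent := h1 I
          _ ≤ d * (d ^ j * m μ (ancestor j I.parent)) := by gcongr
          _ = _ := by ring
      · calc _ ≤ d ^ j * m μ I.parent := ih2
          _ ≤ d ^ j * (d * m μ I) := by gcongr; exact h2 I
          _ = _ := by ring
  refine ⟨d ^ n * d ^ n, one_le_mul_of_one_le_of_one_le (one_le_pow₀ hd1) (one_le_pow₀ hd1), ?_⟩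
  rintro I X Y ⟨i, hi, rfl⟩ ⟨j, hj, hY⟩
  calc m μ X ≤ d ^ i * m μ (ancestor i X) := (up i X).1
    _ = d ^ i * m μ (ancestor j Y) := by rw [hY]
    _ ≤ d ^ i * (d ^ j * m μ Y) := by gcongr; exact (up j Y).2
    _ = d ^ i * d ^ j * m μ Y := by ring
    _ ≤ d ^ n * d ^ n * m μ Y := by
      gcongr
      · exact m_nonneg _

variable [IsLocallyFiniteMeasure μ]

theorem measure_toSet_ne_top (I : DyadicInterval) : μ I.toSet ≠ ∞ := measure_Ico_lt_top.ne

theorem real_eq_add (I : DyadicInterval) :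
    μ.real I.toSet = μ.real I.left.toSet + μ.real I.right.toSet := by
  rw [toSet_eq_union I, measureReal_union (disjoint_left_right I) (measurableSet_toSet _)
    (measure_toSet_ne_top _) (measure_toSet_ne_top _)]

theorem IsAdmissible.integrable (hf : IsAdmissible μ f) : Integrable f μ := by
  obtain ⟨M, hM⟩ := hf.bounded
  rw [← memLp_one_iff_integrable]
  refine hf.hasCompactSupport.memLp_of_bound hf.aestronglyMeasurable M (ae_of_all _ fun x => ?_)
  rw [Real.norm_of_nonneg (hf.nonneg x)]
  exact hM x

theorem mass_eq_add (hf : IsAdmissible μ f) (I : DyadicInterval) :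
    mass μ f I = mass μ f I.left + mass μ f I.right := by
  rw [mass, toSet_eq_union I, setIntegral_union (disjoint_left_right I) (measurableSet_toSet _)
    hf.integrable.integrableOn hf.integrable.integrableOn]
  rfl

theorem real_mul_avg (I : DyadicInterval) : μ.real I.toSet * avg μ f I = mass μ f I := by
  rw [avg_eq]
  rcases eq_or_ne (μ.real I.toSet) 0 with h | h
  · have h' : μ I.toSet = 0 := (measureReal_eq_zero_iff (measure_toSet_ne_top I)).1 h
    rw [h, mass, setIntegral_measure_zero _ h']; simp
  · exact mul_inv_cancel_left₀ h _

theorem m_le_left (I : DyadicInterval) : m μ I ≤ μ.real I.left.toSet := by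
  refine div_le_of_le_mul₀ measureReal_nonneg measureReal_nonneg ?_
  rw [real_eq_add I]
  nlinarith [measureReal_nonneg (μ := μ) (s := I.left.toSet)]

theorem m_le (I : DyadicInterval) : m μ I ≤ μ.real I.toSet := by
  have h1 := m_le_left (μ := μ) I
  have h2 := measureReal_nonneg (μ := μ) (s := I.right.toSet)
  rw [real_eq_add I]; linarith

theorem m_mul_avg_le (hf : IsAdmissible μ f) (I : DyadicInterval) :
    m μ I * avg μ f I ≤ mass μ f I := by
  rw [← real_mul_avg I]
  exact mul_le_mul_of_nonneg_right (m_le I) (avg_nonneg hf I)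

/-- The reason why two adjacent stopping intervals cause no trouble: the product of the averages
over the two children of `I`, weighted by `m I`, only sees the average over `I` itself. -/
theorem m_mul_avg_mul_avg_le {g : ℝ → ℝ} (hf : IsAdmissible μ f) (hg : IsAdmissible μ g)
    (I : DyadicInterval) :
    m μ I * avg μ f I.left * avg μ g I.right ≤ avg μ f I * mass μ g I.right ∧
    m μ I * avg μ f I.right * avg μ g I.left ≤ avg μ f I * mass μ g I.left := by
  have hl := mass_nonneg hf I.left
  have hr := mass_nonneg hf I.right
  have hi : 0 ≤ (μ.real I.toSet)⁻¹ := inv_nonneg.2 measureReal_nonneg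
  constructor
  · calc m μ I * avg μ f I.left * avg μ g I.right
        = (μ.real I.toSet)⁻¹ * (μ.real I.left.toSet * avg μ f I.left)
          * (μ.real I.right.toSet * avg μ g I.right) := by unfold m; ring
      _ = (μ.real I.toSet)⁻¹ * mass μ f I.left * mass μ g I.right := by
          rw [real_mul_avg, real_mul_avg]
      _ ≤ avg μ f I * mass μ g I.right := by
          rw [avg_eq I, mass_eq_add hf I]
          refine mul_le_mul_of_nonneg_right ?_ (mass_nonneg hg _)
          exact mul_le_mul_of_nonneg_left (by linarith) hi
  · calc m μ I * avg μ f I.right * avg μ g I.left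
        = (μ.real I.toSet)⁻¹ * (μ.real I.right.toSet * avg μ f I.right)
          * (μ.real I.left.toSet * avg μ g I.left) := by unfold m; ring
      _ = (μ.real I.toSet)⁻¹ * mass μ f I.right * mass μ g I.left := by
          rw [real_mul_avg, real_mul_avg]
      _ ≤ avg μ f I * mass μ g I.left := by
          rw [avg_eq I, mass_eq_add hf I]
          refine mul_le_mul_of_nonneg_right ?_ (mass_nonneg hg _)
          exact mul_le_mul_of_nonneg_left (by linarith) hi

theorem pairing_haar (hf : IsAdmissible μ f) (J : DyadicInterval) :
    pairing μ f (haar μ J) = √(m μ J) * (avg μ f J.left - avg μ f J.right) := by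
  have key : ∀ K : DyadicInterval,
      Integrable (fun x => f x * K.toSet.indicator (fun _ => (μ.real K.toSet)⁻¹) x) μ ∧
      ∫ x, f x * K.toSet.indicator (fun _ => (μ.real K.toSet)⁻¹) x ∂μ = avg μ f K := by
    intro K
    have h : (fun x => f x * K.toSet.indicator (fun _ => (μ.real K.toSet)⁻¹) x)
        = K.toSet.indicator fun x => (μ.real K.toSet)⁻¹ * f x := by
      funext x
      by_cases hx : x ∈ K.toSet <;> simp [hx, mul_comm]
    rw [h]
    refine ⟨(hf.integrable.const_mul _).indicator (measurableSet_toSet K), ?_⟩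
    rw [integral_indicator (measurableSet_toSet K), integral_const_mul]
    rfl
  have h : ∀ x, f x * haar μ J x = √(m μ J) *
      (f x * J.left.toSet.indicator (fun _ => (μ.real J.left.toSet)⁻¹) x
        - f x * J.right.toSet.indicator (fun _ => (μ.real J.right.toSet)⁻¹) x) := by
    intro x; rw [haar]; ring
  rw [pairing]
  simp_rw [h]
  rw [integral_const_mul, integral_sub (key _).1 (key _).1, (key _).2, (key _).2]

end Averages

/-! ### The stopping family of two functions -/

/-- The stopping condition: one of the averages over `I` is more than four times the
average over `P`. -/
def StopCond (μ : Measure ℝ) (f₁ f₂ : ℝ → ℝ) (I P : DyadicInterval) : Prop :=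
  4 * avg μ f₁ P < avg μ f₁ I ∨ 4 * avg μ f₂ P < avg μ f₂ I

theorem stopCond_comm (μ : Measure ℝ) (f₁ f₂ : ℝ → ℝ) :
    StopCond μ f₁ f₂ = StopCond μ f₂ f₁ := by
  funext I P
  exact propext or_comm

section Corona

variable {μ : Measure ℝ} {f₁ f₂ : ℝ → ℝ} {k₀ : ℤ}

theorem avg_le_avg_host (hf₁ : IsAdmissible μ f₁) {I : DyadicInterval} (h : k₀ ≤ I.k) :
    avg μ f₁ I ≤ 4 * avg μ f₁ (host (StopCond μ f₁ f₂) k₀ I) := by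
  have h0 := avg_nonneg hf₁ I
  rcases h.lt_or_eq with h | h
  · rcases host_eq_or (c := StopCond μ f₁ f₂) h with h' | ⟨h', hc⟩
    · rw [h']; linarith
    · rw [h']
      exact not_lt.1 fun hlt => hc (Or.inl hlt)
  · rw [host_of_le h.ge]; linarith

theorem avg_le_avg_host' (hf₂ : IsAdmissible μ f₂) {I : DyadicInterval} (h : k₀ ≤ I.k) :
    avg μ f₂ I ≤ 4 * avg μ f₂ (host (StopCond μ f₁ f₂) k₀ I) := by
  rw [stopCond_comm]
  exact avg_le_avg_host hf₂ h

variable [IsLocallyFiniteMeasure μ]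

open Classical in
/-- The stopping children of `R` are disjoint subintervals of `R`; stated for the masses of any
admissible function. -/
theorem tsum_mass_isStopChild_le {c : DyadicInterval → DyadicInterval → Prop} {f : ℝ → ℝ}
    (hf : IsAdmissible μ f) {R : DyadicInterval} (hR : R ∈ stopSet c k₀) :
    ∑' Q, (if IsStopChild c k₀ Q R then ENNReal.ofReal (mass μ f Q) else 0)
      ≤ ENNReal.ofReal (mass μ f R) := by
  set ψ : DyadicInterval → ℝ≥0∞ := fun J =>
    if k₀ ≤ J.k ∧ host c k₀ J = R ∨ IsStopChild c k₀ J R then ENNReal.ofReal (mass μ f J) else 0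
    with hψ
  have hψR : ψ R = ENNReal.ofReal (mass μ f R) := if_pos (Or.inl hR)
  rw [← hψR]
  refine tsum_le_of_potential R _ ψ (fun J hJ => ?_) ?_
  · by_cases h : IsStopChild c k₀ J R
    · obtain ⟨j, hj⟩ := h.exists_ancestor
      exact ⟨_, hj⟩
    · simp [h] at hJ
  · rintro J ⟨j, hj⟩
    have hJk : k₀ ≤ J.k := by
      have h1 := hR.1
      rw [← hj, ancestor_k] at h1; omega
    have hle : ∀ X, ψ X ≤ ENNReal.ofReal (mass μ f X) := by
      intro X
      simp only [hψ]
      split_ifs <;> simp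
    -- a child of `J` has a nonzero potential only if `host J = R`
    have hchild : ∀ X : DyadicInterval, X.parent = J → ψ X ≠ 0 → host c k₀ J = R := by
      intro X hX h0
      have hXk : X.k = J.k + 1 := by rw [← hX]; simp [parent]
      by_cases h : k₀ ≤ X.k ∧ host c k₀ X = R ∨ IsStopChild c k₀ X R
      · rcases h with ⟨-, h⟩ | h
        · rcases host_eq_or (c := c) (show k₀ < X.k by omega) with h' | ⟨h', -⟩
          · exfalso
            have h2 : R.k = X.k := by rw [← h, h']
            rw [← hj, ancestor_k] at h2
            omega
          · rw [← h, h', hX]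
        · rw [← hX, h.2.2]
      · exact absurd (if_neg h) h0
    by_cases hJ : IsStopChild c k₀ J R
    · have hne : host c k₀ J ≠ R := by
        intro h
        obtain ⟨i, hi⟩ := hJ.exists_ancestor
        have h2 := congrArg DyadicInterval.k hi
        rw [← h, hJ.2.1, ancestor_k] at h2
        push_cast at h2
        omega
      have hl : ψ J.left = 0 := by
        by_contra h0; exact hne (hchild _ (parent_left J) h0)
      have hr : ψ J.right = 0 := by
        by_contra h0; exact hne (hchild _ (parent_right J) h0)
      rw [hl, hr, if_pos hJ]
      simp [hψ, hJ]
    · rw [if_neg hJ, zero_add]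
      by_cases hs : host c k₀ J = R
      · have h1 : ψ J = ENNReal.ofReal (mass μ f J) := if_pos (Or.inl ⟨hJk, hs⟩)
        rw [h1, mass_eq_add hf, ENNReal.ofReal_add (mass_nonneg hf _) (mass_nonneg hf _)]
        exact add_le_add (hle _) (hle _)
      · have hl : ψ J.left = 0 := by
          by_contra h0; exact hs (hchild _ (parent_left J) h0)
        have hr : ψ J.right = 0 := by
          by_contra h0; exact hs (hchild _ (parent_right J) h0)
        rw [hl, hr]; simp

open Classical in
/-- The stopping children of `R` cover at most half of `R`. -/
theorem tsum_measure_isStopChild_le (hf₁ : IsAdmissible μ f₁) (hf₂ : IsAdmissible μ f₂)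
    {R : DyadicInterval} (hR : R ∈ stopSet (StopCond μ f₁ f₂) k₀) :
    ∑' Q, (if IsStopChild (StopCond μ f₁ f₂) k₀ Q R then μ Q.toSet else 0)
      ≤ ENNReal.ofReal (1 / 2) * μ R.toSet := by
  -- the part of the stopping children chosen because of one function
  have key : ∀ f : ℝ → ℝ, IsAdmissible μ f →
      ∑' Q, (if IsStopChild (StopCond μ f₁ f₂) k₀ Q R ∧ 4 * avg μ f R < avg μ f Q
        then μ Q.toSet else 0) ≤ ENNReal.ofReal (1 / 4) * μ R.toSet := by
    intro f hf
    have hmeas : ∀ X : DyadicInterval, μ X.toSet = ENNReal.ofReal (μ.real X.toSet) := fun X =>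
      (ofReal_measureReal (measure_toSet_ne_top X)).symm
    rcases (avg_nonneg hf R).eq_or_lt with h0 | h0
    · -- `f` has no mass in `R`, hence none in its subintervals
      refine le_of_eq_of_le ?_ zero_le
      rw [ENNReal.tsum_eq_zero]
      intro Q
      refine if_neg fun ⟨hQ, hlt⟩ => ?_
      have hm := (ENNReal.le_tsum Q).trans (tsum_mass_isStopChild_le hf hR)
      rw [if_pos hQ, ← real_mul_avg R, ← h0, mul_zero, ENNReal.ofReal_zero, nonpos_iff_eq_zero,
        ENNReal.ofReal_eq_zero] at hm
      rw [← h0, mul_zero, avg_eq] at hlt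
      have := mul_nonpos_of_nonneg_of_nonpos
        (inv_nonneg.2 (measureReal_nonneg (μ := μ) (s := Q.toSet))) hm
      linarith
    · set a := avg μ f R with ha
      have hle : ∀ Q, (if IsStopChild (StopCond μ f₁ f₂) k₀ Q R ∧ 4 * a < avg μ f Q
          then μ Q.toSet else 0) ≤ ENNReal.ofReal (1 / (4 * a)) *
            (if IsStopChild (StopCond μ f₁ f₂) k₀ Q R then ENNReal.ofReal (mass μ f Q) else 0) := by
        intro Q
        split_ifs with h1 h2 h2
        · rw [← ENNReal.ofReal_mul (by positivity), hmeas]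
          refine ENNReal.ofReal_le_ofReal ?_
          rw [← real_mul_avg Q, div_mul_eq_mul_div, one_mul, le_div_iff₀ (by positivity)]
          exact mul_le_mul_of_nonneg_left h1.2.le measureReal_nonneg
        · exact absurd h1.1 h2
        · exact zero_le
        · exact zero_le
      refine (ENNReal.tsum_le_tsum hle).trans ?_
      rw [ENNReal.tsum_mul_left]
      refine (mul_le_mul_right (tsum_mass_isStopChild_le hf hR) _).trans ?_
      rw [← real_mul_avg R, hmeas, ← ENNReal.ofReal_mul (by positivity),
        ← ENNReal.ofReal_mul (by positivity), ← ha]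
      refine ENNReal.ofReal_le_ofReal (le_of_eq ?_)
      field_simp
  calc ∑' Q, (if IsStopChild (StopCond μ f₁ f₂) k₀ Q R then μ Q.toSet else 0)
      ≤ ∑' Q, ((if IsStopChild (StopCond μ f₁ f₂) k₀ Q R ∧ 4 * avg μ f₁ R < avg μ f₁ Q
          then μ Q.toSet else 0) +
        (if IsStopChild (StopCond μ f₁ f₂) k₀ Q R ∧ 4 * avg μ f₂ R < avg μ f₂ Q
          then μ Q.toSet else 0)) := by
        refine ENNReal.tsum_le_tsum fun Q => ?_
        by_cases h : IsStopChild (StopCond μ f₁ f₂) k₀ Q R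
        · rcases h.cond with h' | h' <;> simp [h, h']
        · simp [h]
    _ ≤ ENNReal.ofReal (1 / 4) * μ R.toSet + ENNReal.ofReal (1 / 4) * μ R.toSet := by
        rw [ENNReal.tsum_add]
        exact add_le_add (key f₁ hf₁) (key f₂ hf₂)
    _ = ENNReal.ofReal (1 / 2) * μ R.toSet := by
        rw [← add_mul, ← ENNReal.ofReal_add (by norm_num) (by norm_num)]
        norm_num

theorem isSparse_stopSet (hf₁ : IsAdmissible μ f₁) (hf₂ : IsAdmissible μ f₂) :
    IsSparse μ (1 / 2) (stopSet (StopCond μ f₁ f₂) k₀) := by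
  classical
  set c := StopCond μ f₁ f₂
  let U : DyadicInterval → Set ℝ := fun I =>
    ⋃ Q : DyadicInterval, ⋃ _ : IsStopChild c k₀ Q I, Q.toSet
  have : Countable DyadicInterval :=
    Function.Injective.countable (f := fun I : DyadicInterval => (I.k, I.p)) fun I J h => by
      ext
      exacts [congrArg Prod.fst h, congrArg Prod.snd h]
  refine ⟨fun I => I.toSet \ U I, fun I hI => ⟨?_, sdiff_subset, ?_⟩, ?_⟩
  · exact (measurableSet_toSet I).diff (MeasurableSet.iUnion fun Q => MeasurableSet.iUnion fun _ =>
      measurableSet_toSet Q)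
  · have hU : μ (U I) ≤ ENNReal.ofReal (1 / 2) * μ I.toSet := by
      refine (measure_iUnion_le _).trans (le_trans (ENNReal.tsum_le_tsum fun Q => ?_)
        (tsum_measure_isStopChild_le hf₁ hf₂ hI))
      split_ifs with h
      · exact measure_mono (iUnion_subset fun _ => subset_rfl)
      · simpa using fun h' => absurd h' h
    have h1 : ENNReal.ofReal (1 / 2) * μ I.toSet + ENNReal.ofReal (1 / 2) * μ I.toSet
        = μ I.toSet := by
      rw [← add_mul, ← ENNReal.ofReal_add (by norm_num) (by norm_num)]
      norm_num
    have hne : ENNReal.ofReal (1 / 2) * μ I.toSet ≠ ∞ :=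
      ENNReal.mul_ne_top ENNReal.ofReal_ne_top (measure_toSet_ne_top I)
    calc ENNReal.ofReal (1 / 2) * μ I.toSet
        = μ I.toSet - ENNReal.ofReal (1 / 2) * μ I.toSet := by
          exact ENNReal.eq_sub_of_add_eq hne h1
      _ ≤ μ I.toSet - μ (U I) := tsub_le_tsub_left hU _
      _ ≤ μ (I.toSet \ U I) := le_measure_sdiff
  · have key : ∀ I ∈ stopSet c k₀, ∀ I' ∈ stopSet c k₀, I ≠ I' → I.k ≤ I'.k → ∀ x,
        x ∈ I.toSet \ U I → x ∉ I'.toSet \ U I' := by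
      intro I hI I' hI' hne hk x hx hx'
      obtain ⟨j, hj⟩ := ancestor_of_mem_toSet hx.1 hx'.1 hk
      cases j with
      | zero => exact hne hj.symm
      | succ j =>
        obtain ⟨Q, i, hi, hQ⟩ := exists_isStopChild hI' hI hj
        refine hx.2 (mem_iUnion₂.2 ⟨Q, hQ, ?_⟩)
        rw [← hi]
        exact toSet_subset_ancestor _ _ hx'.1
    intro I hI I' hI' hne
    rw [Set.disjoint_left]
    intro x hx hx'
    rcases le_total I.k I'.k with h | h
    · exact key I hI I' hI' hne h x hx hx'
    · exact key I' hI' I hI hne.symm h x hx' hx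

end Corona

/-! ### The good part of the Haar coefficients -/

open Classical in
/-- The part of the Haar coefficient `⟨f, h_J⟩` that comes from the children of `J` that are not
stopping intervals. It is the Haar coefficient of the good part of `f` in the
Calderón–Zygmund decomposition adapted to nondoubling measures. -/
noncomputable def goodCoeff (μ : Measure ℝ) (c : DyadicInterval → DyadicInterval → Prop) (k₀ : ℤ)
    (f : ℝ → ℝ) (J : DyadicInterval) : ℝ :=
  √(m μ J) * ((if host c k₀ J.left = J.left then 0 else avg μ f J.left)
    - (if host c k₀ J.right = J.right then 0 else avg μ f J.right))

/-- One step of the energy estimate, where `u, v` are the measures of the two children, `x, y, z`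
the averages over the children and the parent, and `A`, `B` say which children are stopping. The
potential is `a² μ(J) + 2 a μ(J) ⟨f⟩_J - μ(J) ⟨f⟩_J²`; its middle term pays for the mass of `f`
that is lost in the stopping children. -/
theorem energy_step {u v x y z a : ℝ} (hu : 0 ≤ u) (hv : 0 ≤ v) (hx : 0 ≤ x) (hy : 0 ≤ y)
    (hz : 0 ≤ z) (hza : z ≤ a) (hmean : (u + v) * z = u * x + v * y) (A B : Prop) [Decidable A]
    [Decidable B] (hxa : ¬ A → x ≤ a) (hya : ¬ B → y ≤ a) :
    u * v / (u + v) * ((if A then 0 else x) - (if B then 0 else y)) ^ 2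
      + ((if A then 0 else a ^ 2 * u + 2 * a * (u * x) - u * x ^ 2)
        + (if B then 0 else a ^ 2 * v + 2 * a * (v * y) - v * y ^ 2))
      ≤ a ^ 2 * (u + v) + 2 * a * ((u + v) * z) - (u + v) * z ^ 2 := by
  have ha : 0 ≤ a := hz.trans hza
  have hmu : u * v / (u + v) ≤ u := div_le_of_le_mul₀ (by positivity) hu (by nlinarith)
  have hmv : u * v / (u + v) ≤ v := div_le_of_le_mul₀ (by positivity) hv (by nlinarith)
  have hux : 0 ≤ u * x := by positivity
  have hvy : 0 ≤ v * y := by positivity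
  have h2 : (u + v) * z ^ 2 = z * (u * x + v * y) := by rw [← hmean]; ring
  by_cases hA : A <;> by_cases hB : B
  · simp only [if_pos hA, if_pos hB]
    have h1 : z * (u * x + v * y) ≤ a * (u * x + v * y) := by gcongr
    have h3 : 0 ≤ a ^ 2 * (u + v) := by positivity
    have h4 : 0 ≤ a * (u * x + v * y) := by positivity
    rw [h2, hmean]
    nlinarith
  · simp only [if_pos hA, if_neg hB]
    have hya' := hya hB
    have h1 : u * v / (u + v) * (0 - y) ^ 2 ≤ u * a ^ 2 := by
      rw [zero_sub, neg_sq]; gcongr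
    have h3 : z * (u * x) ≤ a * (u * x) := by gcongr
    have h4 : v * (z - y) ≤ u * x := by nlinarith [mul_nonneg hu hz]
    have h5 : y * (v * (z - y)) ≤ a * (u * x) :=
      (mul_le_mul_of_nonneg_left h4 hy).trans (mul_le_mul_of_nonneg_right hya' hux)
    rw [h2, hmean]
    nlinarith
  · simp only [if_neg hA, if_pos hB]
    have hxa' := hxa hA
    have h1 : u * v / (u + v) * (x - 0) ^ 2 ≤ v * a ^ 2 := by
      rw [sub_zero]; gcongr
    have h3 : z * (v * y) ≤ a * (v * y) := by gcongr
    have h4 : u * (z - x) ≤ v * y := by nlinarith [mul_nonneg hv hz]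
    have h5 : x * (u * (z - x)) ≤ a * (v * y) :=
      (mul_le_mul_of_nonneg_left h4 hx).trans (mul_le_mul_of_nonneg_right hxa' hvy)
    rw [h2, hmean]
    nlinarith
  · simp only [if_neg hA, if_neg hB]
    have h1 : u * v / (u + v) * (x - y) ^ 2 = u * x ^ 2 + v * y ^ 2 - (u + v) * z ^ 2 := by
      rcases (add_nonneg hu hv).eq_or_lt with h0 | h0
      · have hu0 : u = 0 := by linarith
        have hv0 : v = 0 := by linarith
        simp [hu0, hv0]
      · have hz' : z = (u * x + v * y) / (u + v) := by
          rw [eq_div_iff h0.ne', mul_comm, hmean]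
        rw [hz']
        field_simp
        ring
    rw [h1, hmean]
    apply le_of_eq
    ring

/-- Below `S`, an interval whose parent does not have stopping ancestor `S` does not have it
either. -/
theorem host_parent_eq {c : DyadicInterval → DyadicInterval → Prop} {k₀ : ℤ}
    {S X J : DyadicInterval} {j : ℕ} (hJ : k₀ ≤ J.k) (hS : ancestor j J = S) (hX : X.parent = J)
    (h : host c k₀ X = S) : host c k₀ J = S ∧ host c k₀ X ≠ X := by
  have hXk : X.k = J.k + 1 := by rw [← hX]; simp [parent]
  have hne : host c k₀ X ≠ X := by
    intro h'
    have h2 : S.k = X.k := by rw [← h, h']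
    rw [← hS, ancestor_k] at h2
    omega
  rcases host_eq_or (c := c) (show k₀ < X.k by omega) with h' | ⟨h', -⟩
  · exact absurd h' hne
  · exact ⟨by rw [← h, h', hX], hne⟩

section Good

variable {μ : Measure ℝ} {f f₁ f₂ : ℝ → ℝ} {k₀ : ℤ}
  {c : DyadicInterval → DyadicInterval → Prop}

theorem goodCoeff_eq_zero (hf : IsAdmissible μ f)
    (hc : ∀ I : DyadicInterval, k₀ ≤ I.k → avg μ f I ≤ 4 * avg μ f (host c k₀ I))
    {J : DyadicInterval} (hJ : k₀ ≤ J.k) (h : avg μ f (host c k₀ J) = 0) :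
    goodCoeff μ c k₀ f J = 0 := by
  have hchild : ∀ X : DyadicInterval, X.parent = J → ¬ host c k₀ X = X → avg μ f X = 0 := by
    intro X hX hne
    have hXk : X.k = J.k + 1 := by rw [← hX]; simp [parent]
    have h1 := hc X (by omega)
    rcases host_eq_or (c := c) (show k₀ < X.k by omega) with h' | ⟨h', -⟩
    · exact absurd h' hne
    · rw [h', hX, h, mul_zero] at h1
      exact le_antisymm h1 (avg_nonneg hf X)
  have hl := hchild _ (parent_left J)
  have hr := hchild _ (parent_right J)
  rw [goodCoeff]
  split_ifs with h1 h2 h2 <;> simp_all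

/-- The square of a good coefficient of `f₁`, weighted so that the sum over the intervals with a
common stopping ancestor is comparable to a term of the sparse form. -/
noncomputable def goodEnergy (μ : Measure ℝ) (c : DyadicInterval → DyadicInterval → Prop) (k₀ : ℤ)
    (f₁ f₂ : ℝ → ℝ) (J : DyadicInterval) : ℝ :=
  goodCoeff μ c k₀ f₁ J ^ 2 * (avg μ f₂ (host c k₀ J) / avg μ f₁ (host c k₀ J))

theorem goodCoeff_mul_le (hf₁ : IsAdmissible μ f₁) (hf₂ : IsAdmissible μ f₂)
    (hc₁ : ∀ I : DyadicInterval, k₀ ≤ I.k → avg μ f₁ I ≤ 4 * avg μ f₁ (host c k₀ I))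
    (hc₂ : ∀ I : DyadicInterval, k₀ ≤ I.k → avg μ f₂ I ≤ 4 * avg μ f₂ (host c k₀ I))
    {J K : DyadicInterval} (hJ : k₀ ≤ J.k) (hK : k₀ ≤ K.k) (h : host c k₀ J = host c k₀ K) :
    |goodCoeff μ c k₀ f₁ J * goodCoeff μ c k₀ f₂ K| ≤
      goodEnergy μ c k₀ f₁ f₂ J + goodEnergy μ c k₀ f₂ f₁ K := by
  have h₁ := avg_nonneg hf₁ (host c k₀ K)
  have h₂ := avg_nonneg hf₂ (host c k₀ K)
  rcases h₁.eq_or_lt with ha | ha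
  · rw [goodCoeff_eq_zero hf₁ hc₁ hJ (by rw [h, ← ha]), goodEnergy, goodEnergy, ← ha]
    simp [h, ← ha]
  rcases h₂.eq_or_lt with hb | hb
  · rw [goodCoeff_eq_zero hf₂ hc₂ hK hb.symm, goodEnergy, goodEnergy]
    simp [h, ← hb]
  rw [goodEnergy, goodEnergy, h, abs_mul, ← sq_abs (goodCoeff μ c k₀ f₁ J),
    ← sq_abs (goodCoeff μ c k₀ f₂ K)]
  set a := avg μ f₁ (host c k₀ K)
  set b := avg μ f₂ (host c k₀ K)
  have hg := abs_nonneg (goodCoeff μ c k₀ f₁ J)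
  have hg' := abs_nonneg (goodCoeff μ c k₀ f₂ K)
  set g := |goodCoeff μ c k₀ f₁ J|
  set g' := |goodCoeff μ c k₀ f₂ K|
  have h3 : g ^ 2 * (b / a) + g' ^ 2 * (a / b) - g * g'
      = ((g * b - g' * a) ^ 2 + g * g' * (a * b)) / (a * b) := by
    field_simp
    ring
  have h4 : 0 ≤ g ^ 2 * (b / a) + g' ^ 2 * (a / b) - g * g' := by
    rw [h3]; positivity
  linarith

variable [IsLocallyFiniteMeasure μ]

open Classical in
/-- The good coefficients attached to one stopping interval satisfy a Carleson type bound. -/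
theorem tsum_goodCoeff_sq_le (hf : IsAdmissible μ f)
    (hc : ∀ I : DyadicInterval, k₀ ≤ I.k → avg μ f I ≤ 4 * avg μ f (host c k₀ I))
    {S : DyadicInterval} (hS : S ∈ stopSet c k₀) :
    ∑' J, (if k₀ ≤ J.k ∧ host c k₀ J = S then ENNReal.ofReal (goodCoeff μ c k₀ f J ^ 2) else 0)
      ≤ ENNReal.ofReal (24 * avg μ f S ^ 2 * μ.real S.toSet) := by
  set a := 4 * avg μ f S with ha
  have ha0 : 0 ≤ a := by have := avg_nonneg hf S; positivity
  let p : DyadicInterval → ℝ := fun J => a ^ 2 * μ.real J.toSet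
    + 2 * a * (μ.real J.toSet * avg μ f J) - μ.real J.toSet * avg μ f J ^ 2
  have hp : ∀ J, avg μ f J ≤ a → 0 ≤ p J := by
    intro J hJ
    have h0 := avg_nonneg hf J
    have h1 : avg μ f J ^ 2 ≤ a ^ 2 := by gcongr
    have h2 := mul_le_mul_of_nonneg_left h1 (measureReal_nonneg (μ := μ) (s := J.toSet))
    have h3 : 0 ≤ 2 * a * (μ.real J.toSet * avg μ f J) := by positivity
    simp only [p]
    linarith
  set ψ : DyadicInterval → ℝ≥0∞ := fun J =>
    if k₀ ≤ J.k ∧ host c k₀ J = S then ENNReal.ofReal (p J) else 0 with hψ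
  have hψS : ψ S ≤ ENNReal.ofReal (24 * avg μ f S ^ 2 * μ.real S.toSet) := by
    rw [hψ]
    simp only [hS.1, hS.2, and_self, if_true]
    refine ENNReal.ofReal_le_ofReal ?_
    simp only [p, ha]
    have h3 : 0 ≤ μ.real S.toSet * avg μ f S ^ 2 := by positivity
    nlinarith
  refine (tsum_le_of_potential S _ ψ (fun J hJ => ?_) ?_).trans hψS
  · by_cases h : k₀ ≤ J.k ∧ host c k₀ J = S
    · rw [← h.2]; exact exists_ancestor_eq_host h.1
    · simp [h] at hJ
  rintro J ⟨j, hj⟩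
  have hJk : k₀ ≤ J.k := by
    have h1 := hS.1
    rw [← hj, ancestor_k] at h1; omega
  by_cases hs : host c k₀ J = S
  · -- the potential of a child vanishes exactly if the child is a stopping interval
    have hchild : ∀ X : DyadicInterval, X.parent = J →
        ψ X = ENNReal.ofReal (if host c k₀ X = X then 0 else p X) ∧
        (¬ host c k₀ X = X → avg μ f X ≤ a) := by
      intro X hX
      have hXk : X.k = J.k + 1 := by rw [← hX]; simp [parent]
      by_cases hXS : host c k₀ X = S
      · have hne := (host_parent_eq hJk hj hX hXS).2
        refine ⟨?_, fun _ => ?_⟩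
        · rw [if_neg hne]
          exact if_pos ⟨by omega, hXS⟩
        · have := hc X (by omega)
          rwa [hXS] at this
      · have h1 : host c k₀ X = X := by
          rcases host_eq_or (c := c) (show k₀ < X.k by omega) with h' | ⟨h', -⟩
          · exact h'
          · exact absurd (by rw [h', hX, hs]) hXS
        refine ⟨?_, fun h => absurd h1 h⟩
        rw [if_pos h1, ENNReal.ofReal_zero]
        exact if_neg fun h => hXS h.2
    obtain ⟨hl, hla⟩ := hchild _ (parent_left J)
    obtain ⟨hr, hra⟩ := hchild _ (parent_right J)
    have hza : avg μ f J ≤ a := by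
      have := hc J hJk
      rwa [hs] at this
    have hpl : 0 ≤ if host c k₀ J.left = J.left then 0 else p J.left := by
      split_ifs with h
      exacts [le_rfl, hp _ (hla h)]
    have hpr : 0 ≤ if host c k₀ J.right = J.right then 0 else p J.right := by
      split_ifs with h
      exacts [le_rfl, hp _ (hra h)]
    have hψJ : ψ J = ENNReal.ofReal (p J) := if_pos ⟨hJk, hs⟩
    rw [if_pos ⟨hJk, hs⟩, hl, hr, hψJ, ← ENNReal.ofReal_add hpl hpr,
      ← ENNReal.ofReal_add (sq_nonneg _) (add_nonneg hpl hpr)]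
    refine ENNReal.ofReal_le_ofReal ?_
    have hmean : (μ.real J.left.toSet + μ.real J.right.toSet) * avg μ f J
        = μ.real J.left.toSet * avg μ f J.left + μ.real J.right.toSet * avg μ f J.right := by
      rw [← real_eq_add, real_mul_avg, real_mul_avg, real_mul_avg, mass_eq_add hf]
    have := energy_step measureReal_nonneg measureReal_nonneg (avg_nonneg hf J.left)
      (avg_nonneg hf J.right) (avg_nonneg hf J) hza hmean _ _ hla hra
    rw [← real_eq_add] at this
    rw [goodCoeff, mul_pow, Real.sq_sqrt (m_nonneg J)]
    exact this
  · have hz : ∀ X : DyadicInterval, X.parent = J → ψ X = 0 := fun X hX =>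
      if_neg fun h => hs (host_parent_eq hJk hj hX h.2).1
    rw [hz _ (parent_left J), hz _ (parent_right J), if_neg fun h => hs h.2]
    simp

open Classical in
theorem tsum_goodEnergy_le (hf₁ : IsAdmissible μ f₁) (hf₂ : IsAdmissible μ f₂)
    (hc₁ : ∀ I : DyadicInterval, k₀ ≤ I.k → avg μ f₁ I ≤ 4 * avg μ f₁ (host c k₀ I)) :
    ∑' J : DyadicInterval,
        (if k₀ ≤ J.k then ENNReal.ofReal (goodEnergy μ c k₀ f₁ f₂ J) else 0)
      ≤ 24 * sparseForm μ (stopSet c k₀) f₁ f₂ := by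
  have hsum : ∀ J : DyadicInterval,
      (if k₀ ≤ J.k then ENNReal.ofReal (goodEnergy μ c k₀ f₁ f₂ J) else 0)
      = ∑' S : DyadicInterval, if S = host c k₀ J then
        (if k₀ ≤ J.k then ENNReal.ofReal (goodEnergy μ c k₀ f₁ f₂ J) else 0) else 0 :=
    fun J => (tsum_ite_eq (host c k₀ J) fun _ =>
      (if k₀ ≤ J.k then ENNReal.ofReal (goodEnergy μ c k₀ f₁ f₂ J) else 0)).symm
  rw [tsum_congr hsum, ENNReal.tsum_comm, sparseForm,
    tsum_subtype (stopSet c k₀) fun I =>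
      ENNReal.ofReal (avg μ f₁ I * avg μ f₂ I * μ.real I.toSet), ← ENNReal.tsum_mul_left]
  refine ENNReal.tsum_le_tsum fun S => ?_
  by_cases hS : S ∈ stopSet c k₀
  · rw [indicator_of_mem hS]
    have h₁ := avg_nonneg hf₁ S
    have h₂ := avg_nonneg hf₂ S
    have hterm : ∀ J : DyadicInterval, (if S = host c k₀ J then
        (if k₀ ≤ J.k then ENNReal.ofReal (goodEnergy μ c k₀ f₁ f₂ J) else 0) else 0)
        = ENNReal.ofReal (avg μ f₂ S / avg μ f₁ S) *
          (if k₀ ≤ J.k ∧ host c k₀ J = S then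
            ENNReal.ofReal (goodCoeff μ c k₀ f₁ J ^ 2) else 0) := by
      intro J
      by_cases h1 : host c k₀ J = S <;> by_cases h2 : k₀ ≤ J.k
      · rw [if_pos h1.symm, if_pos h2, if_pos ⟨h2, h1⟩, ← ENNReal.ofReal_mul (by positivity),
          goodEnergy, h1, mul_comm]
      all_goals simp [h1, h2, eq_comm (a := S)]
    rw [tsum_congr hterm, ENNReal.tsum_mul_left]
    refine (mul_le_mul_right (tsum_goodCoeff_sq_le hf₁ hc₁ hS) _).trans ?_
    rw [← ENNReal.ofReal_mul (by positivity), show (24 : ℝ≥0∞) = ENNReal.ofReal 24 by simp,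
      ← ENNReal.ofReal_mul (by norm_num)]
    refine ENNReal.ofReal_le_ofReal (le_of_eq ?_)
    rcases h₁.eq_or_lt with h0 | h0
    · simp [← h0]
    · field_simp
  · refine le_of_eq_of_le ?_ zero_le
    rw [ENNReal.tsum_eq_zero]
    intro J
    by_cases h1 : S = host c k₀ J <;> by_cases h2 : k₀ ≤ J.k
    · exact absurd (h1 ▸ host_mem h2) hS
    all_goals simp [h1, h2]

end Good

/-! ### Pairs of children with different stopping ancestors -/

theorem sparseForm_comm (μ : Measure ℝ) (f₁ f₂ : ℝ → ℝ) (S : Set DyadicInterval) :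
    sparseForm μ S f₁ f₂ = sparseForm μ S f₂ f₁ := by
  simp only [sparseForm]
  exact tsum_congr fun I => by rw [mul_comm (avg μ f₁ _)]

section Rest

variable {μ : Measure ℝ} [IsLocallyFiniteMeasure μ] {f f₁ f₂ : ℝ → ℝ} {k₀ : ℤ}
  {c : DyadicInterval → DyadicInterval → Prop}

theorem mass_le_mass_ancestor (hf : IsAdmissible μ f) (j : ℕ) (I : DyadicInterval) :
    mass μ f I ≤ mass μ f (ancestor j I) :=
  setIntegral_mono_set hf.integrable.integrableOn (ae_of_all _ hf.nonneg)
    (toSet_subset_ancestor j I).eventuallyLE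

/-- If `X` and `Y` lie in `I` and the stopping interval `P` contains `X` but not `host Y`, then
`P` is strictly smaller than `I`. -/
theorem near_of_not_ancestor {n : ℕ} {X Y I P : DyadicInterval} (hX : Near n X I)
    (hY : Near n Y I) {l : ℕ} (hl : ancestor l X = P) (hP : P ∈ stopSet c k₀)
    (h : ∀ i, ancestor i (host c k₀ Y) ≠ P) :
    ∃ i, ancestor i P = I ∧ ancestor (i + l) X = I := by
  obtain ⟨i₀, -, hi₀⟩ := hX
  obtain ⟨i₁, -, hi₁⟩ := hY
  rcases le_total I.k P.k with hk | hk
  · obtain ⟨h1, h2⟩ := ancestor_of_ancestor hl hi₀ hk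
    exact ⟨i₀ - l, h2, by rw [Nat.sub_add_cancel h1, hi₀]⟩
  · obtain ⟨-, h2⟩ := ancestor_of_ancestor hi₀ hl hk
    rw [← hi₁, ← ancestor_add] at h2
    obtain ⟨i, hi⟩ := host_minimal hP h2
    exact absurd hi (h i)

theorem eq_of_ancestor_eq {X I : DyadicInterval} {i j : ℕ} (hi : ancestor i X = I)
    (hj : ancestor j X = I) : i = j := by
  have := congrArg DyadicInterval.k (hi.trans hj.symm)
  rw [ancestor_k, ancestor_k] at this
  omega

/-- A pair whose stopping ancestors are strictly nested is charged to a stopping child of the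
larger one. -/
theorem nested_pair_le (hf₁ : IsAdmissible μ f₁) (hf₂ : IsAdmissible μ f₂)
    (hc₂ : ∀ I : DyadicInterval, k₀ ≤ I.k → avg μ f₂ I ≤ 4 * avg μ f₂ (host c k₀ I))
    {n : ℕ} {X Y I : DyadicInterval} (hX : Near n X I) (hY : Near n Y I) (hXk : k₀ ≤ X.k)
    (hYk : k₀ ≤ Y.k) {j : ℕ} (h : ancestor (j + 1) (host c k₀ X) = host c k₀ Y)
    {w κ : ℝ} (hκ : 0 ≤ κ) (hw : w ≤ κ * m μ X) :
    ∃ Q, Near n Q I ∧ IsStopChild c k₀ Q (host c k₀ Y) ∧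
      w * (avg μ f₁ X * avg μ f₂ Y) ≤ 4 * κ * (mass μ f₁ Q * avg μ f₂ (host c k₀ Y)) := by
  obtain ⟨Q, i, hi, hQ⟩ := exists_isStopChild (host_mem hXk) (host_mem hYk) h
  obtain ⟨l, hl⟩ := exists_ancestor_eq_host (c := c) hXk
  have hQX : ancestor (i + l) X = Q := by rw [ancestor_add, hl, hi]
  obtain ⟨r, hr, hr'⟩ := near_of_not_ancestor hX hY hQX hQ.mem fun a ha => by
    obtain ⟨b, hb⟩ := hQ.exists_ancestor
    rw [← ha, ← ancestor_add] at hb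
    have := eq_of_ancestor_eq hb (ancestor_zero _)
    omega
  refine ⟨Q, ⟨r, ?_, hr⟩, hQ, ?_⟩
  · obtain ⟨i₀, hle, hi₀⟩ := hX
    have := eq_of_ancestor_eq hi₀ hr'
    omega
  · have h1 : mass μ f₁ X ≤ mass μ f₁ Q := by rw [← hQX]; exact mass_le_mass_ancestor hf₁ _ _
    have h2 := avg_nonneg hf₁ X
    have h3 := avg_nonneg hf₂ Y
    have h4 := mass_nonneg hf₁ X
    calc w * (avg μ f₁ X * avg μ f₂ Y) ≤ κ * m μ X * (avg μ f₁ X * avg μ f₂ Y) := by gcongr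
      _ = κ * ((m μ X * avg μ f₁ X) * avg μ f₂ Y) := by ring
      _ ≤ κ * (mass μ f₁ Q * (4 * avg μ f₂ (host c k₀ Y))) := by
          gcongr
          · exact h4.trans h1
          · exact (m_mul_avg_le hf₁ X).trans h1
          · exact hc₂ Y hYk
      _ = _ := by ring

theorem exists_ancestor_of_dyadicDist_lt {P R : DyadicInterval} {n : ℕ∞}
    (h : dyadicDist P R < n) : ∃ s t : ℕ, ancestor s P = ancestor t R ∧ ((s + t : ℕ) : ℕ∞) < n := by
  rw [dyadicDist] at h
  simp only [iInf_lt_iff] at h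
  obtain ⟨s, t, h1, h2⟩ := h
  exact ⟨s, t, h1, h2⟩

theorem dyadicDist_le {P R : DyadicInterval} {s t : ℕ} (h : ancestor s P = ancestor t R) :
    dyadicDist P R ≤ ((s + t : ℕ) : ℕ∞) :=
  iInf_le_of_le s (iInf_le_of_le t (iInf_le_of_le h le_rfl))

theorem disjoint_of_not_ancestor {P R : DyadicInterval} (h₁ : ∀ i, ancestor i P ≠ R)
    (h₂ : ∀ i, ancestor i R ≠ P) : Disjoint P.toSet R.toSet := by
  rw [Set.disjoint_left]
  intro x hP hR
  rcases le_total P.k R.k with h | h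
  · obtain ⟨j, hj⟩ := ancestor_of_mem_toSet hP hR h
    exact h₂ j hj
  · obtain ⟨j, hj⟩ := ancestor_of_mem_toSet hR hP h
    exact h₁ j hj

/-- A pair of adjacent stopping intervals is charged to one of them, `R`, as a stopping child of the
stopping ancestor of the common parent. -/
theorem sibling_pair_le (hf₁ : IsAdmissible μ f₁) (hf₂ : IsAdmissible μ f₂)
    (hc₁ : ∀ I : DyadicInterval, k₀ ≤ I.k → avg μ f₁ I ≤ 4 * avg μ f₁ (host c k₀ I))
    {P R : DyadicInterval} (hR : R ∈ stopSet c k₀) (hRk : k₀ < R.k) (hPR : P.parent = R.parent)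
    (hne : P ≠ R) :
    IsStopChild c k₀ R (host c k₀ R.parent) ∧
      m μ R.parent * (avg μ f₁ P * avg μ f₂ R)
        ≤ 4 * (mass μ f₂ R * avg μ f₁ (host c k₀ R.parent)) := by
  refine ⟨⟨hRk, hR.2, rfl⟩, ?_⟩
  have hk : k₀ ≤ R.parent.k := by simp only [parent]; omega
  have h1 : m μ R.parent * (avg μ f₁ P * avg μ f₂ R) ≤ avg μ f₁ R.parent * mass μ f₂ R := by
    obtain ⟨h2, h3⟩ := m_mul_avg_mul_avg_le hf₁ hf₂ R.parent
    rw [← mul_assoc]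
    rcases eq_left_or_right_parent P with hP | hP <;>
    rcases eq_left_or_right_parent R with hR | hR <;> rw [hPR] at hP
    · exact absurd (hP.trans hR.symm) hne
    · rwa [← hP, ← hR] at h2
    · rwa [← hP, ← hR] at h3
    · exact absurd (hP.trans hR.symm) hne
  refine h1.trans ?_
  have h4 := mul_le_mul_of_nonneg_right (hc₁ _ hk) (mass_nonneg hf₂ R)
  linarith

open Classical in
/-- The target to which pairs of children are charged, as a function of a pair of stopping
intervals: a term of the sparse form on the diagonal, the mass of one function in a stopping
child times the average of the other one over the stopping parent, and a term of the modified
sparse form. -/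
noncomputable def target (μ : Measure ℝ) (c : DyadicInterval → DyadicInterval → Prop) (k₀ : ℤ)
    (N : ℕ) (f₁ f₂ : ℝ → ℝ) (y : DyadicInterval × DyadicInterval) : ℝ≥0∞ :=
  (if y.1 = y.2 then (stopSet c k₀).indicator
    (fun P => ENNReal.ofReal (avg μ f₁ P * avg μ f₂ P * μ.real P.toSet)) y.1 else 0) +
  ((if IsStopChild c k₀ y.1 y.2 then ENNReal.ofReal (mass μ f₁ y.1 * avg μ f₂ y.2) else 0) +
  (if IsStopChild c k₀ y.1 y.2 then ENNReal.ofReal (mass μ f₂ y.1 * avg μ f₁ y.2) else 0)) +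
  {q : DyadicInterval × DyadicInterval | q.1 ∈ stopSet c k₀ ∧ q.2 ∈ stopSet c k₀ ∧
    2 < dyadicDist q.1 q.2 ∧ dyadicDist q.1 q.2 ≤ ((N + 2 : ℕ) : ℕ∞) ∧
    Disjoint q.1.toSet q.2.toSet}.indicator
    (fun q => ENNReal.ofReal (avg μ f₁ q.1 * avg μ f₂ q.2 * √(m μ q.1) * √(m μ q.2))) y

open Classical in
theorem tsum_isStopChild_le (hf₁ : IsAdmissible μ f₁) (hf₂ : IsAdmissible μ f₂) :
    ∑' y : DyadicInterval × DyadicInterval,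
      (if IsStopChild c k₀ y.1 y.2 then ENNReal.ofReal (mass μ f₁ y.1 * avg μ f₂ y.2) else 0)
      ≤ sparseForm μ (stopSet c k₀) f₁ f₂ := by
  rw [ENNReal.tsum_prod', ENNReal.tsum_comm, sparseForm,
    tsum_subtype (stopSet c k₀) fun I =>
      ENNReal.ofReal (avg μ f₁ I * avg μ f₂ I * μ.real I.toSet)]
  refine ENNReal.tsum_le_tsum fun R => ?_
  by_cases hR : R ∈ stopSet c k₀
  · rw [indicator_of_mem hR]
    have h₂ := avg_nonneg hf₂ R
    have hterm : ∀ Q : DyadicInterval, (if IsStopChild c k₀ Q R then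
        ENNReal.ofReal (mass μ f₁ Q * avg μ f₂ R) else 0) = ENNReal.ofReal (avg μ f₂ R) *
        (if IsStopChild c k₀ Q R then ENNReal.ofReal (mass μ f₁ Q) else 0) := by
      intro Q
      split_ifs
      · rw [← ENNReal.ofReal_mul h₂, mul_comm]
      · simp
    simp only
    rw [tsum_congr hterm, ENNReal.tsum_mul_left]
    refine (mul_le_mul_right (tsum_mass_isStopChild_le hf₁ hR) _).trans ?_
    rw [← ENNReal.ofReal_mul h₂, ← real_mul_avg R]
    refine ENNReal.ofReal_le_ofReal (le_of_eq ?_)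
    ring
  · refine le_of_eq_of_le ?_ zero_le
    rw [ENNReal.tsum_eq_zero]
    exact fun Q => if_neg fun h => hR h.mem_right

theorem tsum_target_le (N : ℕ) (hf₁ : IsAdmissible μ f₁) (hf₂ : IsAdmissible μ f₂) :
    ∑' y, target μ c k₀ N f₁ f₂ y ≤ 3 * sparseForm μ (stopSet c k₀) f₁ f₂
      + modifiedForm μ N (stopSet c k₀) f₁ f₂ := by
  classical
  simp only [target]
  rw [ENNReal.tsum_add, ENNReal.tsum_add, ENNReal.tsum_add]
  refine add_le_add ?_ ?_
  · rw [show (3 : ℝ≥0∞) = 1 + (1 + 1) by norm_num, add_mul, add_mul, one_mul]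
    refine add_le_add (le_of_eq ?_) (add_le_add (tsum_isStopChild_le hf₁ hf₂) ?_)
    · rw [ENNReal.tsum_prod', sparseForm, tsum_subtype (stopSet c k₀) fun I =>
        ENNReal.ofReal (avg μ f₁ I * avg μ f₂ I * μ.real I.toSet)]
      refine tsum_congr fun P => ?_
      simp only [eq_comm (a := P)]
      rw [tsum_ite_eq]
    · rw [sparseForm_comm]
      exact tsum_isStopChild_le hf₂ hf₁
  · exact (tsum_subtype {q : DyadicInterval × DyadicInterval | q.1 ∈ stopSet c k₀ ∧
      q.2 ∈ stopSet c k₀ ∧ 2 < dyadicDist q.1 q.2 ∧ dyadicDist q.1 q.2 ≤ ((N + 2 : ℕ) : ℕ∞) ∧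
      Disjoint q.1.toSet q.2.toSet} fun q =>
      ENNReal.ofReal (avg μ f₁ q.1 * avg μ f₂ q.2 * √(m μ q.1) * √(m μ q.2))).ge

/-- Every pair of children, at complexity at most `N`, that is not covered by the good parts can be
charged to a target inside the common ancestor `I`. -/
theorem exists_target (hf₁ : IsAdmissible μ f₁) (hf₂ : IsAdmissible μ f₂)
    (hc₁ : ∀ I : DyadicInterval, k₀ ≤ I.k → avg μ f₁ I ≤ 4 * avg μ f₁ (host c k₀ I))
    (hc₂ : ∀ I : DyadicInterval, k₀ ≤ I.k → avg μ f₂ I ≤ 4 * avg μ f₂ (host c k₀ I))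
    {N : ℕ} {κ : ℝ} (hκ : 1 ≤ κ)
    (hm : ∀ I X Y : DyadicInterval, Near (N + 1) X I → Near (N + 1) Y I → m μ X ≤ κ * m μ Y)
    {s t : ℕ} (hst : s + t ≤ N) {I J K X Y : DyadicInterval} (hIk : k₀ ≤ I.k)
    (hJ : ancestor s J = I) (hK : ancestor t K = I) (hX : X.parent = J) (hY : Y.parent = K)
    (h : ¬ (host c k₀ X = host c k₀ Y ∧ host c k₀ X ≠ X ∧ host c k₀ Y ≠ Y)) :
    ∃ y : DyadicInterval × DyadicInterval, Near (N + 1) y.1 I ∧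
      ENNReal.ofReal (√(m μ J) * √(m μ K) * (avg μ f₁ X * avg μ f₂ Y)) ≤
        ENNReal.ofReal (64 * κ) * target μ c k₀ N f₁ f₂ y := by
  have hX' : ancestor (s + 1) X = I := by rw [ancestor_succ, hX, hJ]
  have hY' : ancestor (t + 1) Y = I := by rw [ancestor_succ, hY, hK]
  have nJ : Near (N + 1) J I := ⟨s, by omega, hJ⟩
  have nK : Near (N + 1) K I := ⟨t, by omega, hK⟩
  have nX : Near (N + 1) X I := ⟨s + 1, by omega, hX'⟩
  have nY : Near (N + 1) Y I := ⟨t + 1, by omega, hY'⟩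
  have hXk : k₀ ≤ X.k := by rw [← hX', ancestor_k] at hIk; push_cast at hIk; omega
  have hYk : k₀ ≤ Y.k := by rw [← hY', ancestor_k] at hIk; push_cast at hIk; omega
  have hκ0 : 0 ≤ κ := by linarith
  set w := √(m μ J) * √(m μ K) with hw
  have hw0 : 0 ≤ w := by positivity
  have hw2 : ∀ P R, Near (N + 1) P I → Near (N + 1) R I → w ≤ κ * (√(m μ P) * √(m μ R)) := by
    intro P R hP hR
    have h1 : √(m μ J) ≤ √κ * √(m μ P) := by
      rw [← Real.sqrt_mul hκ0]; exact Real.sqrt_le_sqrt (hm I J P nJ hP)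
    have h2 : √(m μ K) ≤ √κ * √(m μ R) := by
      rw [← Real.sqrt_mul hκ0]; exact Real.sqrt_le_sqrt (hm I K R nK hR)
    calc w ≤ (√κ * √(m μ P)) * (√κ * √(m μ R)) := by rw [hw]; gcongr
      _ = (√κ * √κ) * (√(m μ P) * √(m μ R)) := by ring
      _ = κ * (√(m μ P) * √(m μ R)) := by rw [Real.mul_self_sqrt hκ0]
  have hw1 : ∀ P, Near (N + 1) P I → w ≤ κ * m μ P := by
    intro P hP
    have := hw2 P P hP hP
    rwa [Real.mul_self_sqrt (m_nonneg P)] at this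
  -- a real inequality with a smaller constant suffices
  have fin : ∀ (r : ℝ) (y : DyadicInterval × DyadicInterval), 0 ≤ r →
      w * (avg μ f₁ X * avg μ f₂ Y) ≤ 64 * κ * r →
      ENNReal.ofReal r ≤ target μ c k₀ N f₁ f₂ y →
      ENNReal.ofReal (w * (avg μ f₁ X * avg μ f₂ Y)) ≤
        ENNReal.ofReal (64 * κ) * target μ c k₀ N f₁ f₂ y := by
    intro r y hr h1 h2
    refine (ENNReal.ofReal_le_ofReal h1).trans ?_
    rw [ENNReal.ofReal_mul (by positivity)]
    exact mul_le_mul_right h2 _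
  have hX0 := avg_nonneg hf₁ X
  have hY0 := avg_nonneg hf₂ Y
  have hPX := hc₁ X hXk
  have hRY := hc₂ Y hYk
  have hPm := host_mem (c := c) hXk
  have hRm := host_mem (c := c) hYk
  have hP0 := avg_nonneg hf₁ (host c k₀ X)
  have hR0 := avg_nonneg hf₂ (host c k₀ Y)
  have hprod : avg μ f₁ X * avg μ f₂ Y ≤
      16 * (avg μ f₁ (host c k₀ X) * avg μ f₂ (host c k₀ Y)) := by
    calc avg μ f₁ X * avg μ f₂ Y
        ≤ (4 * avg μ f₁ (host c k₀ X)) * (4 * avg μ f₂ (host c k₀ Y)) := by gcongr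
      _ = _ := by ring
  by_cases hPR : host c k₀ X = host c k₀ Y
  · -- one of the two intervals is the common stopping ancestor
    have hor : host c k₀ X = X ∨ host c k₀ X = Y := by
      by_contra hcon
      push Not at hcon
      exact h ⟨hPR, hcon.1, hPR ▸ hcon.2⟩
    rw [← hPR] at hprod hR0
    set P := host c k₀ X
    have nP : Near (N + 1) P I := by
      rcases hor with h' | h' <;> rw [h'] <;> assumption
    refine ⟨(P, P), nP, fin (avg μ f₁ P * avg μ f₂ P * μ.real P.toSet) _ (by positivity) ?_ ?_⟩
    · have h1 : w ≤ κ * μ.real P.toSet :=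
        (hw1 P nP).trans (mul_le_mul_of_nonneg_left (m_le P) hκ0)
      calc w * (avg μ f₁ X * avg μ f₂ Y)
          ≤ (κ * μ.real P.toSet) * (16 * (avg μ f₁ P * avg μ f₂ P)) := by gcongr
        _ = 16 * (κ * (avg μ f₁ P * avg μ f₂ P * μ.real P.toSet)) := by ring
        _ ≤ 64 * (κ * (avg μ f₁ P * avg μ f₂ P * μ.real P.toSet)) := by gcongr; norm_num
        _ = _ := by ring
    · simp only [target, if_true, indicator_of_mem hPm, add_assoc]
      exact le_self_add
  by_cases hPR' : ∃ i, ancestor i (host c k₀ X) = host c k₀ Y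
  · obtain ⟨i, hi⟩ := hPR'
    cases i with
    | zero => exact absurd hi hPR
    | succ j =>
      obtain ⟨Q, hQI, hQ, hle⟩ := nested_pair_le hf₁ hf₂ hc₂ nX nY hXk hYk hi hκ0 (hw1 X nX)
      have hM := mass_nonneg hf₁ Q
      have hr : 0 ≤ mass μ f₁ Q * avg μ f₂ (host c k₀ Y) := by positivity
      refine ⟨(Q, host c k₀ Y), hQI, fin (mass μ f₁ Q * avg μ f₂ (host c k₀ Y)) _ hr ?_ ?_⟩
      · refine hle.trans ?_
        gcongr
        norm_num
      · simp only [target, if_pos hQ]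
        exact le_add_right (le_add_left le_self_add)
  by_cases hRP : ∃ i, ancestor i (host c k₀ Y) = host c k₀ X
  · obtain ⟨i, hi⟩ := hRP
    cases i with
    | zero => exact absurd hi.symm hPR
    | succ j =>
      obtain ⟨Q, hQI, hQ, hle⟩ := nested_pair_le hf₂ hf₁ hc₁ nY nX hYk hXk hi hκ0 (hw1 Y nY)
      have hM := mass_nonneg hf₂ Q
      have hr : 0 ≤ mass μ f₂ Q * avg μ f₁ (host c k₀ X) := by positivity
      refine ⟨(Q, host c k₀ X), hQI, fin (mass μ f₂ Q * avg μ f₁ (host c k₀ X)) _ hr ?_ ?_⟩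
      · rw [mul_comm (avg μ f₁ X)]
        refine hle.trans ?_
        gcongr
        norm_num
      · simp only [target, if_pos hQ]
        exact le_add_right (le_add_left le_add_self)
  · push Not at hPR' hRP
    set P := host c k₀ X
    set R := host c k₀ Y
    obtain ⟨l, hl⟩ := exists_ancestor_eq_host (c := c) hXk
    obtain ⟨l', hl'⟩ := exists_ancestor_eq_host (c := c) hYk
    obtain ⟨i, hi, hi'⟩ := near_of_not_ancestor nX nY hl hPm hRP
    obtain ⟨i', hi₁, hi₁'⟩ := near_of_not_ancestor nY nX hl' hRm hPR'
    have e1 := eq_of_ancestor_eq hi' hX'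
    have e2 := eq_of_ancestor_eq hi₁' hY'
    have nP : Near (N + 1) P I := ⟨i, by omega, hi⟩
    have nR : Near (N + 1) R I := ⟨i', by omega, hi₁⟩
    by_cases hd : 2 < dyadicDist P R
    · have hd' : dyadicDist P R ≤ ((N + 2 : ℕ) : ℕ∞) :=
        (dyadicDist_le (hi.trans hi₁.symm)).trans (by exact_mod_cast (by omega))
      refine ⟨(P, R), nP, fin (avg μ f₁ P * avg μ f₂ R * √(m μ P) * √(m μ R)) _
        (by positivity) ?_ ?_⟩
      · calc w * (avg μ f₁ X * avg μ f₂ Y)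
            ≤ (κ * (√(m μ P) * √(m μ R))) * (16 * (avg μ f₁ P * avg μ f₂ R)) := by
              gcongr
              exact hw2 P R nP nR
          _ = 16 * (κ * (avg μ f₁ P * avg μ f₂ R * √(m μ P) * √(m μ R))) := by ring
          _ ≤ 64 * (κ * (avg μ f₁ P * avg μ f₂ R * √(m μ P) * √(m μ R))) := by
              gcongr; norm_num
          _ = _ := by ring
      · rw [target, indicator_of_mem (show (P, R) ∈ {q : DyadicInterval × DyadicInterval |
          q.1 ∈ stopSet c k₀ ∧ q.2 ∈ stopSet c k₀ ∧ 2 < dyadicDist q.1 q.2 ∧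
          dyadicDist q.1 q.2 ≤ ((N + 2 : ℕ) : ℕ∞) ∧ Disjoint q.1.toSet q.2.toSet} from
          ⟨hPm, hRm, hd, hd', disjoint_of_not_ancestor hPR' hRP⟩)]
        exact le_add_self
    · -- disjoint intervals at distance at most two are siblings
      obtain ⟨a, b, hab, hlt⟩ := exists_ancestor_of_dyadicDist_lt
        (show dyadicDist P R < ((3 : ℕ) : ℕ∞) from lt_of_le_of_lt (not_lt.1 hd) (by norm_num))
      have hlt' : a + b < 3 := by exact_mod_cast hlt
      have ha : a ≠ 0 := by rintro rfl; exact hRP b hab.symm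
      have hb : b ≠ 0 := by rintro rfl; exact hPR' a hab
      obtain rfl : a = 1 := by omega
      obtain rfl : b = 1 := by omega
      have hpar : P.parent = R.parent := hab
      have hi0 : i' ≠ 0 := by
        rintro rfl
        exact hPR' i (hi.trans hi₁.symm)
      obtain ⟨i'', rfl⟩ := Nat.exists_eq_succ_of_ne_zero hi0
      have hRk : k₀ < R.k := by
        have h1 : (ancestor (i'' + 1) R).k = I.k := congrArg _ hi₁
        rw [ancestor_k] at h1
        push_cast at h1
        omega
      obtain ⟨hQ, hle⟩ := sibling_pair_le hf₁ hf₂ hc₁ hRm hRk hpar hPR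
      have hA := avg_nonneg hf₁ (host c k₀ R.parent)
      have hM := mass_nonneg hf₂ R
      have hr : 0 ≤ mass μ f₂ R * avg μ f₁ (host c k₀ R.parent) := by positivity
      refine ⟨(R, host c k₀ R.parent), nR,
        fin (mass μ f₂ R * avg μ f₁ (host c k₀ R.parent)) _ hr ?_ ?_⟩
      · have nRp : Near (N + 1) R.parent I := ⟨i'', by omega, hi₁⟩
        calc w * (avg μ f₁ X * avg μ f₂ Y)
            ≤ (κ * m μ R.parent) * (16 * (avg μ f₁ P * avg μ f₂ R)) := by
              gcongr
              · exact mul_nonneg hκ0 (m_nonneg _)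
              · exact hw1 _ nRp
          _ = 16 * κ * (m μ R.parent * (avg μ f₁ P * avg μ f₂ R)) := by ring
          _ ≤ 16 * κ * (4 * (mass μ f₂ R * avg μ f₁ (host c k₀ R.parent))) := by gcongr
          _ = _ := by ring
      · simp only [target, if_pos hQ]
        exact le_add_right (le_add_left le_add_self)

end Rest

/-! ### Finite sums of Haar coefficients -/

/-- The two children of an interval, indexed by `Bool`. -/
def child : Bool → DyadicInterval → DyadicInterval
  | false => left
  | true => right

theorem parent_child (b : Bool) (I : DyadicInterval) : (child b I).parent = I := by
  cases b
  exacts [parent_left I, parent_right I]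

theorem abs_sub_mul_sub_le {x₁ x₂ y₁ y₂ : ℝ} (hx₁ : 0 ≤ x₁) (hx₂ : 0 ≤ x₂) (hy₁ : 0 ≤ y₁)
    (hy₂ : 0 ≤ y₂) (A₁ A₂ B₁ B₂ : Prop) [Decidable A₁] [Decidable A₂] [Decidable B₁]
    [Decidable B₂] :
    |(x₁ - x₂) * (y₁ - y₂)| ≤
      |((if A₁ then 0 else x₁) - (if A₂ then 0 else x₂)) *
        ((if B₁ then 0 else y₁) - (if B₂ then 0 else y₂))| +
      ((if A₁ ∨ B₁ then x₁ * y₁ else 0) + (if A₁ ∨ B₂ then x₁ * y₂ else 0) +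
        (if A₂ ∨ B₁ then x₂ * y₁ else 0) + (if A₂ ∨ B₂ then x₂ * y₂ else 0)) := by
  have e : ∀ (A B : Prop) [Decidable A] [Decidable B] (x y : ℝ), 0 ≤ x → 0 ≤ y →
      0 ≤ (if A ∨ B then x * y else 0) ∧
      x * y = (if A then 0 else x) * (if B then 0 else y) + (if A ∨ B then x * y else 0) := by
    intro A B _ _ x y hx hy
    by_cases hA : A <;> by_cases hB : B <;> simp [hA, hB] <;> positivity
  obtain ⟨n₁, e₁⟩ := e A₁ B₁ x₁ y₁ hx₁ hy₁
  obtain ⟨n₂, e₂⟩ := e A₁ B₂ x₁ y₂ hx₁ hy₂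
  obtain ⟨n₃, e₃⟩ := e A₂ B₁ x₂ y₁ hx₂ hy₁
  obtain ⟨n₄, e₄⟩ := e A₂ B₂ x₂ y₂ hx₂ hy₂
  have h1 := neg_abs_le (((if A₁ then 0 else x₁) - (if A₂ then 0 else x₂)) *
    ((if B₁ then 0 else y₁) - (if B₂ then 0 else y₂)))
  have h2 := le_abs_self (((if A₁ then 0 else x₁) - (if A₂ then 0 else x₂)) *
    ((if B₁ then 0 else y₁) - (if B₂ then 0 else y₂)))
  have h3 : (x₁ - x₂) * (y₁ - y₂) = ((if A₁ then 0 else x₁) - (if A₂ then 0 else x₂)) *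
      ((if B₁ then 0 else y₁) - (if B₂ then 0 else y₂)) +
      ((if A₁ ∨ B₁ then x₁ * y₁ else 0) - (if A₁ ∨ B₂ then x₁ * y₂ else 0) -
        (if A₂ ∨ B₁ then x₂ * y₁ else 0) + (if A₂ ∨ B₂ then x₂ * y₂ else 0)) := by
    linear_combination e₁ - e₂ - e₃ + e₄
  rw [abs_le]
  constructor <;> linarith

section FiniteSum

variable {μ : Measure ℝ} [IsLocallyFiniteMeasure μ] {f₁ f₂ : ℝ → ℝ} {k₀ : ℤ}
  {c : DyadicInterval → DyadicInterval → Prop}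

open Classical in
/-- The product of two Haar coefficients splits into the product of the good coefficients, present
only if the stopping ancestors agree, and pairs of children which either have different stopping
ancestors or contain a stopping interval. -/
theorem abs_pairing_mul_pairing_le (hf₁ : IsAdmissible μ f₁) (hf₂ : IsAdmissible μ f₂)
    {J K : DyadicInterval} (hJ : k₀ ≤ J.k) (hK : k₀ ≤ K.k) :
    |pairing μ f₁ (haar μ J) * pairing μ f₂ (haar μ K)| ≤
      (if host c k₀ J = host c k₀ K then
        |goodCoeff μ c k₀ f₁ J * goodCoeff μ c k₀ f₂ K| else 0) +
      ∑ p : Bool × Bool, if ¬ (host c k₀ (child p.1 J) = host c k₀ (child p.2 K) ∧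
          host c k₀ (child p.1 J) ≠ child p.1 J ∧ host c k₀ (child p.2 K) ≠ child p.2 K) then
        √(m μ J) * √(m μ K) * (avg μ f₁ (child p.1 J) * avg μ f₂ (child p.2 K)) else 0 := by
  have hw : 0 ≤ √(m μ J) * √(m μ K) := by positivity
  have hx : ∀ b, 0 ≤ avg μ f₁ (child b J) := fun b => avg_nonneg hf₁ _
  have hy : ∀ b, 0 ≤ avg μ f₂ (child b K) := fun b => avg_nonneg hf₂ _
  have habs : |pairing μ f₁ (haar μ J) * pairing μ f₂ (haar μ K)| = √(m μ J) * √(m μ K) *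
      |(avg μ f₁ (child false J) - avg μ f₁ (child true J)) *
        (avg μ f₂ (child false K) - avg μ f₂ (child true K))| := by
    rw [pairing_haar hf₁, pairing_haar hf₂]
    conv_rhs => rw [← abs_of_nonneg hw, ← abs_mul]
    congr 1
    simp only [child]
    ring
  rw [habs]
  have hst : ∀ (b : Bool) (I : DyadicInterval), k₀ ≤ I.k → host c k₀ (child b I) ≠ child b I →
      host c k₀ (child b I) = host c k₀ I := by
    intro b I hI hne
    have hk : (child b I).k = I.k + 1 := by cases b <;> rfl
    rcases host_eq_or (c := c) (show k₀ < (child b I).k by omega) with h' | ⟨h', -⟩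
    · exact absurd h' hne
    · rw [h', parent_child]
  rw [Fintype.sum_prod_type]
  simp only [Fintype.sum_bool]
  by_cases h : host c k₀ J = host c k₀ K
  · have hiff : ∀ b b', (¬ (host c k₀ (child b J) = host c k₀ (child b' K) ∧
        host c k₀ (child b J) ≠ child b J ∧ host c k₀ (child b' K) ≠ child b' K)) ↔
        (host c k₀ (child b J) = child b J ∨ host c k₀ (child b' K) = child b' K) := by
      intro b b'
      constructor
      · intro h1
        by_contra h2
        push Not at h2
        exact h1 ⟨by rw [hst b J hJ h2.1, hst b' K hK h2.2, h], h2.1, h2.2⟩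
      · rintro (h1 | h1) ⟨-, h2, h3⟩
        exacts [h2 h1, h3 h1]
    simp only [hiff]
    rw [if_pos h]
    have hgood : |goodCoeff μ c k₀ f₁ J * goodCoeff μ c k₀ f₂ K| = √(m μ J) * √(m μ K) *
        |((if host c k₀ (child false J) = child false J then 0 else avg μ f₁ (child false J)) -
          (if host c k₀ (child true J) = child true J then 0 else avg μ f₁ (child true J))) *
        ((if host c k₀ (child false K) = child false K then 0 else avg μ f₂ (child false K)) -
          (if host c k₀ (child true K) = child true K then 0 else avg μ f₂ (child true K)))| := by
      rw [goodCoeff, goodCoeff]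
      conv_rhs => rw [← abs_of_nonneg hw, ← abs_mul]
      congr 1
      exact mul_mul_mul_comm _ _ _ _
    rw [hgood]
    refine (mul_le_mul_of_nonneg_left (abs_sub_mul_sub_le (hx false) (hx true) (hy false)
      (hy true) (host c k₀ (child false J) = child false J)
      (host c k₀ (child true J) = child true J) (host c k₀ (child false K) = child false K)
      (host c k₀ (child true K) = child true K)) hw).trans (le_of_eq ?_)
    simp only [mul_add, mul_ite, mul_zero]
    ring
  · have htrue : ∀ b b', ¬ (host c k₀ (child b J) = host c k₀ (child b' K) ∧
        host c k₀ (child b J) ≠ child b J ∧ host c k₀ (child b' K) ≠ child b' K) :=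
      fun b b' ⟨h1, h2, h3⟩ => h (by rw [← hst b J hJ h2, ← hst b' K hK h3, h1])
    simp only [if_pos (htrue _ _)]
    rw [if_neg h]
    refine (mul_le_mul_of_nonneg_left (abs_sub_mul_sub_le (hx false) (hx true) (hy false)
      (hy true) True True True True) hw).trans (le_of_eq ?_)
    simp only [if_true, true_or, sub_self, mul_zero, abs_zero]
    ring

open Classical in
theorem sum_goodCoeff_mul_le (hf₁ : IsAdmissible μ f₁) (hf₂ : IsAdmissible μ f₂)
    (hc₁ : ∀ I : DyadicInterval, k₀ ≤ I.k → avg μ f₁ I ≤ 4 * avg μ f₁ (host c k₀ I))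
    (hc₂ : ∀ I : DyadicInterval, k₀ ≤ I.k → avg μ f₂ I ≤ 4 * avg μ f₂ (host c k₀ I))
    {s t N : ℕ} (hst : s + t ≤ N) (G : Finset (DyadicInterval × DyadicInterval))
    (hG : ∀ x ∈ G, ancestor s x.1 = ancestor t x.2 ∧ k₀ ≤ x.1.k ∧ k₀ ≤ x.2.k) :
    ∑ x ∈ G, ENNReal.ofReal (if host c k₀ x.1 = host c k₀ x.2 then
      |goodCoeff μ c k₀ f₁ x.1 * goodCoeff μ c k₀ f₂ x.2| else 0) ≤
      48 * 2 ^ N * sparseForm μ (stopSet c k₀) f₁ f₂ := by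
  let E₁ : DyadicInterval → ℝ≥0∞ := fun J =>
    if k₀ ≤ J.k then ENNReal.ofReal (goodEnergy μ c k₀ f₁ f₂ J) else 0
  let E₂ : DyadicInterval → ℝ≥0∞ := fun J =>
    if k₀ ≤ J.k then ENNReal.ofReal (goodEnergy μ c k₀ f₂ f₁ J) else 0
  have h1 : ∑ x ∈ G, E₁ x.1 ≤ ((2 ^ N : ℕ) : ℝ≥0∞) * ∑' J, E₁ J := by
    refine sum_le_mul_tsum_of_charge G _ E₁ (fun x y => x.1 = y) _ (fun y => ?_)
      fun x _ => ⟨x.1, rfl, le_rfl⟩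
    refine ⟨{y} ×ˢ descendants t (ancestor s y), ?_, ?_⟩
    · rw [Finset.card_product, Finset.card_singleton, one_mul]
      exact (card_descendants_le _ _).trans (Nat.pow_le_pow_right two_pos (by omega))
    · rintro ⟨J, K⟩ hx rfl
      simp only [Finset.mem_product, Finset.mem_singleton, true_and]
      rw [(hG _ hx).1]
      exact mem_descendants_ancestor t K
  have h2 : ∑ x ∈ G, E₂ x.2 ≤ ((2 ^ N : ℕ) : ℝ≥0∞) * ∑' J, E₂ J := by
    refine sum_le_mul_tsum_of_charge G _ E₂ (fun x y => x.2 = y) _ (fun y => ?_)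
      fun x _ => ⟨x.2, rfl, le_rfl⟩
    refine ⟨descendants s (ancestor t y) ×ˢ {y}, ?_, ?_⟩
    · rw [Finset.card_product, Finset.card_singleton, mul_one]
      exact (card_descendants_le _ _).trans (Nat.pow_le_pow_right two_pos (by omega))
    · rintro ⟨J, K⟩ hx rfl
      simp only [Finset.mem_product, Finset.mem_singleton, and_true]
      rw [← (hG _ hx).1]
      exact mem_descendants_ancestor s J
  have h3 : ∀ x ∈ G, ENNReal.ofReal (if host c k₀ x.1 = host c k₀ x.2 then
      |goodCoeff μ c k₀ f₁ x.1 * goodCoeff μ c k₀ f₂ x.2| else 0) ≤ E₁ x.1 + E₂ x.2 := by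
    intro x hx
    obtain ⟨-, hJ, hK⟩ := hG x hx
    split_ifs with h
    · simp only [E₁, E₂, if_pos hJ, if_pos hK]
      exact (ENNReal.ofReal_le_ofReal (goodCoeff_mul_le hf₁ hf₂ hc₁ hc₂ hJ hK h)).trans
        ENNReal.ofReal_add_le
    · simp
  refine (Finset.sum_le_sum h3).trans ?_
  rw [Finset.sum_add_distrib]
  refine (add_le_add (h1.trans (mul_le_mul_right (tsum_goodEnergy_le hf₁ hf₂ hc₁) _))
    (h2.trans (mul_le_mul_right (tsum_goodEnergy_le hf₂ hf₁ hc₂) _))).trans (le_of_eq ?_)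
  rw [sparseForm_comm μ f₂ f₁]
  push_cast
  ring

open Classical in
theorem sum_children_le (hf₁ : IsAdmissible μ f₁) (hf₂ : IsAdmissible μ f₂)
    (hc₁ : ∀ I : DyadicInterval, k₀ ≤ I.k → avg μ f₁ I ≤ 4 * avg μ f₁ (host c k₀ I))
    (hc₂ : ∀ I : DyadicInterval, k₀ ≤ I.k → avg μ f₂ I ≤ 4 * avg μ f₂ (host c k₀ I))
    {s t N : ℕ} (hst : s + t ≤ N) {κ : ℝ} (hκ : 1 ≤ κ)
    (hm : ∀ I X Y : DyadicInterval, Near (N + 1) X I → Near (N + 1) Y I → m μ X ≤ κ * m μ Y)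
    (G : Finset (DyadicInterval × DyadicInterval))
    (hG : ∀ x ∈ G, ancestor s x.1 = ancestor t x.2 ∧ k₀ ≤ (ancestor s x.1).k) :
    ∑ x ∈ G, ∑ p : Bool × Bool, ENNReal.ofReal (
      if ¬ (host c k₀ (child p.1 x.1) = host c k₀ (child p.2 x.2) ∧
        host c k₀ (child p.1 x.1) ≠ child p.1 x.1 ∧ host c k₀ (child p.2 x.2) ≠ child p.2 x.2) then
        √(m μ x.1) * √(m μ x.2) * (avg μ f₁ (child p.1 x.1) * avg μ f₂ (child p.2 x.2)) else 0) ≤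
      (((N + 2) * (2 ^ N * 4) : ℕ) : ℝ≥0∞) * (ENNReal.ofReal (64 * κ) *
        (3 * sparseForm μ (stopSet c k₀) f₁ f₂ + modifiedForm μ N (stopSet c k₀) f₁ f₂)) := by
  refine le_trans ?_ (mul_le_mul_right (mul_le_mul_right
    (tsum_target_le (c := c) (k₀ := k₀) N hf₁ hf₂) _) _)
  rw [← Finset.sum_product', ← ENNReal.tsum_mul_left]
  refine sum_le_mul_tsum_of_charge _ _ _
    (fun (z : (DyadicInterval × DyadicInterval) × (Bool × Bool)) y =>
      Near (N + 1) y.1 (ancestor s z.1.1)) _ (fun y => ?_) (fun z hz => ?_)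
  · refine ⟨(Finset.range (N + 2)).biUnion fun i => (descendants s (ancestor i y.1) ×ˢ
      descendants t (ancestor i y.1)) ×ˢ (Finset.univ : Finset (Bool × Bool)), ?_, ?_⟩
    · refine (Finset.card_biUnion_le_card_mul _ _ (2 ^ N * 4) fun i _ => ?_).trans ?_
      · rw [Finset.card_product, Finset.card_product]
        refine Nat.mul_le_mul ?_ (by simp)
        refine (Nat.mul_le_mul (card_descendants_le _ _) (card_descendants_le _ _)).trans ?_
        rw [← pow_add]
        exact Nat.pow_le_pow_right two_pos hst
      · rw [Finset.card_range]
    · rintro ⟨⟨J, K⟩, p⟩ hz ⟨i, hi, hiI⟩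
      have hx := (hG _ (Finset.mem_product.1 hz).1).1
      simp only at hx hiI
      simp only [Finset.mem_biUnion, Finset.mem_product, Finset.mem_univ, and_true]
      refine ⟨i, Finset.mem_range.2 (by omega), ?_, ?_⟩
      · rw [hiI]; exact mem_descendants_ancestor s J
      · rw [hiI, hx]; exact mem_descendants_ancestor t K
  · obtain ⟨hx, hk⟩ := hG _ (Finset.mem_product.1 hz).1
    by_cases h : ¬ (host c k₀ (child z.2.1 z.1.1) = host c k₀ (child z.2.2 z.1.2) ∧
        host c k₀ (child z.2.1 z.1.1) ≠ child z.2.1 z.1.1 ∧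
        host c k₀ (child z.2.2 z.1.2) ≠ child z.2.2 z.1.2)
    · rw [if_pos h]
      exact exists_target hf₁ hf₂ hc₁ hc₂ hκ hm hst hk rfl hx.symm (parent_child _ _)
        (parent_child _ _) h
    · rw [if_neg h]
      exact ⟨(z.1.1, z.1.1), ⟨s, by omega, rfl⟩, by simp⟩

/-- The sparse bound for finitely many products of Haar coefficients. -/
theorem sum_abs_pairing_mul_pairing_le (hf₁ : IsAdmissible μ f₁) (hf₂ : IsAdmissible μ f₂)
    {s t N : ℕ} (hst : s + t ≤ N) {κ : ℝ} (hκ : 1 ≤ κ)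
    (hm : ∀ I X Y : DyadicInterval, Near (N + 1) X I → Near (N + 1) Y I → m μ X ≤ κ * m μ Y)
    (G : Finset (DyadicInterval × DyadicInterval))
    (hG : ∀ x ∈ G, ancestor s x.1 = ancestor t x.2 ∧ k₀ ≤ (ancestor s x.1).k) :
    ∑ x ∈ G, ENNReal.ofReal |pairing μ f₁ (haar μ x.1) * pairing μ f₂ (haar μ x.2)| ≤
      (48 * 2 ^ N + 3 * (((N + 2) * (2 ^ N * 4) : ℕ) * ENNReal.ofReal (64 * κ))) *
        (sparseForm μ (stopSet (StopCond μ f₁ f₂) k₀) f₁ f₂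
          + modifiedForm μ N (stopSet (StopCond μ f₁ f₂) k₀) f₁ f₂) := by
  classical
  set c := StopCond μ f₁ f₂
  have hc₁ : ∀ I : DyadicInterval, k₀ ≤ I.k → avg μ f₁ I ≤ 4 * avg μ f₁ (host c k₀ I) :=
    fun I hI => avg_le_avg_host hf₁ hI
  have hc₂ : ∀ I : DyadicInterval, k₀ ≤ I.k → avg μ f₂ I ≤ 4 * avg μ f₂ (host c k₀ I) :=
    fun I hI => avg_le_avg_host' hf₂ hI
  have hk : ∀ x ∈ G, k₀ ≤ x.1.k ∧ k₀ ≤ x.2.k := by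
    intro x hx
    obtain ⟨h1, h2⟩ := hG x hx
    have h3 := h2
    rw [h1, ancestor_k] at h3
    rw [ancestor_k] at h2
    omega
  have hterm : ∀ x ∈ G, ENNReal.ofReal |pairing μ f₁ (haar μ x.1) * pairing μ f₂ (haar μ x.2)| ≤
      ENNReal.ofReal (if host c k₀ x.1 = host c k₀ x.2 then
        |goodCoeff μ c k₀ f₁ x.1 * goodCoeff μ c k₀ f₂ x.2| else 0) +
      ∑ p : Bool × Bool, ENNReal.ofReal (
        if ¬ (host c k₀ (child p.1 x.1) = host c k₀ (child p.2 x.2) ∧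
        host c k₀ (child p.1 x.1) ≠ child p.1 x.1 ∧ host c k₀ (child p.2 x.2) ≠ child p.2 x.2) then
        √(m μ x.1) * √(m μ x.2) * (avg μ f₁ (child p.1 x.1) * avg μ f₂ (child p.2 x.2))
        else 0) := by
    intro x hx
    refine (ENNReal.ofReal_le_ofReal (abs_pairing_mul_pairing_le (c := c) hf₁ hf₂ (hk x hx).1
      (hk x hx).2)).trans (ENNReal.ofReal_add_le.trans (add_le_add le_rfl (le_of_eq ?_)))
    refine ENNReal.ofReal_sum_of_nonneg fun p _ => ?_
    have h1 := avg_nonneg hf₁ (child p.1 x.1)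
    have h2 := avg_nonneg hf₂ (child p.2 x.2)
    split_ifs <;> positivity
  refine (Finset.sum_le_sum hterm).trans ?_
  rw [Finset.sum_add_distrib]
  refine (add_le_add (sum_goodCoeff_mul_le hf₁ hf₂ hc₁ hc₂ hst G fun x hx =>
    ⟨(hG x hx).1, hk x hx⟩) (sum_children_le hf₁ hf₂ hc₁ hc₂ hst hκ hm G hG)).trans ?_
  set S := sparseForm μ (stopSet c k₀) f₁ f₂
  set M := modifiedForm μ N (stopSet c k₀) f₁ f₂
  rw [add_mul (48 * 2 ^ N : ℝ≥0∞)]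
  refine add_le_add (mul_le_mul_right (le_self_add : S ≤ S + M) _) ?_
  have h3 : 3 * S + M ≤ 3 * (S + M) := by
    rw [mul_add]
    refine add_le_add le_rfl ?_
    calc M = 1 * M := (one_mul M).symm
      _ ≤ 3 * M := by gcongr; norm_num
  refine (mul_le_mul_right (mul_le_mul_right h3 _) _).trans (le_of_eq ?_)
  ring

end FiniteSum

/-! ### Haar shifts -/

theorem pairing_congr {μ : Measure ℝ} {f f' g g' : ℝ → ℝ} (hf : f =ᵐ[μ] f')
    (hg : g =ᵐ[μ] g') : pairing μ f g = pairing μ f' g' :=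
  integral_congr_ae (hf.mul hg)

section Shift

variable {μ : Measure ℝ} [IsLocallyFiniteMeasure μ] {f₁ f₂ : ℝ → ℝ}

theorem inner_toL2 (hf : IsAdmissible μ f₁) (g : Lp ℝ 2 μ) :
    inner ℝ hf.toL2 g = pairing μ g f₁ := by
  rw [L2.inner_def, pairing]
  refine integral_congr_ae ?_
  filter_upwards [hf.memLp.coeFn_toLp] with x hx
  simp only [IsAdmissible.toL2, hx, RCLike.inner_apply, conj_trivial]

/-- The bilinear form of a Haar shift as a series of products of Haar coefficients. -/
theorem hasSum_pairing (hf₁ : IsAdmissible μ f₁) (hf₂ : IsAdmissible μ f₂) {s t : ℕ}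
    {T : Lp ℝ 2 μ → Lp ℝ 2 μ} {α : DyadicInterval → DyadicInterval → DyadicInterval → ℝ}
    (hT : ∀ f : Lp ℝ 2 μ, HasSum (fun q : ShiftIndex s t =>
        (α q.1.1 q.1.2.1 q.1.2.2 * pairing μ f (haar μ q.1.2.1)) • haarL2 μ q.1.2.2) (T f)) :
    HasSum (fun q : ShiftIndex s t => α q.1.1 q.1.2.1 q.1.2.2 *
      (pairing μ f₁ (haar μ q.1.2.1) * pairing μ f₂ (haar μ q.1.2.2)))
      (pairing μ (T hf₁.toL2) f₂) := by
  have h := (innerSL ℝ hf₂.toL2).hasSum (hT hf₁.toL2)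
  have h1 : ∀ J, pairing μ hf₁.toL2 (haar μ J) = pairing μ f₁ (haar μ J) := fun J =>
    pairing_congr hf₁.memLp.coeFn_toLp Filter.EventuallyEq.rfl
  have h2 : ∀ K, pairing μ (haarL2 μ K) f₂ = pairing μ f₂ (haar μ K) := fun K =>
    (pairing_congr (memLp_haar μ K).coeFn_toLp Filter.EventuallyEq.rfl).trans
      (integral_congr_ae (ae_of_all _ fun x => mul_comm _ _))
  simp only [innerSL_apply_apply, inner_smul_right, inner_toL2, h1, h2, mul_assoc] at h
  exact h

end Shift

end BalancedSparse

theorem theorem2p3 (μ : Measure ℝ) [IsLocallyFiniteMeasure μ] [NullSingletonClass μ]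
    (hμ : IsBalanced μ) (N : ℕ) :
    ∃ η : ℝ, 0 < η ∧ η < 1 ∧ ∃ C : ℝ≥0,
      ∀ s t : ℕ, s + t ≤ N → ∀ T ∈ HS μ s t,
        ∀ (f₁ f₂ : ℝ → ℝ) (hf₁ : IsAdmissible μ f₁) (_ : IsAdmissible μ f₂),
          ∃ S : Set DyadicInterval, IsSparse μ η S ∧
            ENNReal.ofReal |pairing μ (T hf₁.toL2) f₂| ≤
              C * (sparseForm μ S f₁ f₂ + modifiedForm μ N S f₁ f₂) := by
  classical
  obtain ⟨κ, hκ, hm⟩ := hμ.exists_m_le (N + 1)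
  set C₀ : ℝ≥0 := 48 * 2 ^ N + 3 * (((N + 2) * (2 ^ N * 4) : ℕ) * (64 * κ).toNNReal) with hC₀
  refine ⟨1 / 2, by norm_num, by norm_num, 2 * C₀, ?_⟩
  rintro s t hst T ⟨α, hα, hT⟩ f₁ f₂ hf₁ hf₂
  set P := pairing μ (T hf₁.toL2) f₂ with hP
  have hsum := hasSum_pairing hf₁ hf₂ hT
  -- a finite part of the series carries at least half of its sum
  obtain ⟨F, hF⟩ : ∃ F : Finset (ShiftIndex s t), |P| ≤ 2 * |∑ q ∈ F, α q.1.1 q.1.2.1 q.1.2.2 *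
      (pairing μ f₁ (haar μ q.1.2.1) * pairing μ f₂ (haar μ q.1.2.2))| := by
    rcases (abs_nonneg P).eq_or_lt with h0 | h0
    · exact ⟨∅, by simp [← h0]⟩
    · obtain ⟨F, hF⟩ := (hsum.abs.eventually (lt_mem_nhds (half_lt_self h0))).exists
      exact ⟨F, by linarith⟩
  -- the top intervals are chosen as long as the longest interval in this finite part
  obtain ⟨k₀, hk₀⟩ : ∃ k₀ : ℤ, ∀ q ∈ F, k₀ ≤ q.1.1.k := by
    obtain ⟨k, hk⟩ := (F.image fun q => q.1.1.k).bddBelow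
    exact ⟨k, fun q hq => hk (Finset.mem_coe.2 (Finset.mem_image_of_mem _ hq))⟩
  refine ⟨stopSet (StopCond μ f₁ f₂) k₀, isSparse_stopSet hf₁ hf₂, ?_⟩
  let G := F.image fun q : ShiftIndex s t => (q.1.2.1, q.1.2.2)
  have hG : ∀ x ∈ G, DyadicInterval.ancestor s x.1 = DyadicInterval.ancestor t x.2 ∧
      k₀ ≤ (DyadicInterval.ancestor s x.1).k := by
    intro x hx
    obtain ⟨q, hq, rfl⟩ := Finset.mem_image.1 hx
    refine ⟨q.2.1.trans q.2.2.symm, ?_⟩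
    rw [q.2.1]
    exact hk₀ q hq
  have hinj : Set.InjOn (fun q : ShiftIndex s t => (q.1.2.1, q.1.2.2)) F := by
    intro q _ q' _ h
    have h1 := congrArg Prod.fst h
    have h2 := congrArg Prod.snd h
    simp only at h1 h2
    exact Subtype.ext (Prod.ext (by rw [← q.2.1, ← q'.2.1, h1]) (Prod.ext h1 h2))
  have hle : |∑ q ∈ F, α q.1.1 q.1.2.1 q.1.2.2 *
      (pairing μ f₁ (haar μ q.1.2.1) * pairing μ f₂ (haar μ q.1.2.2))| ≤
      ∑ x ∈ G, |pairing μ f₁ (haar μ x.1) * pairing μ f₂ (haar μ x.2)| := by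
    rw [Finset.sum_image hinj]
    refine (Finset.abs_sum_le_sum_abs _ _).trans (Finset.sum_le_sum fun q _ => ?_)
    rw [abs_mul]
    exact mul_le_of_le_one_left (abs_nonneg _) (hα _ _ _)
  have hmain := sum_abs_pairing_mul_pairing_le hf₁ hf₂ hst hκ hm G hG
  rw [← ENNReal.ofReal_sum_of_nonneg fun _ _ => abs_nonneg _] at hmain
  calc ENNReal.ofReal |P|
      ≤ ENNReal.ofReal (2 * ∑ x ∈ G, |pairing μ f₁ (haar μ x.1) * pairing μ f₂ (haar μ x.2)|) :=
        ENNReal.ofReal_le_ofReal (by linarith)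
    _ = 2 * ENNReal.ofReal (∑ x ∈ G, |pairing μ f₁ (haar μ x.1) * pairing μ f₂ (haar μ x.2)|) := by
        rw [ENNReal.ofReal_mul (by norm_num)]; simp
    _ ≤ 2 * (C₀ * (sparseForm μ (stopSet (StopCond μ f₁ f₂) k₀) f₁ f₂
          + modifiedForm μ N (stopSet (StopCond μ f₁ f₂) k₀) f₁ f₂)) := by
        refine mul_le_mul_right (hmain.trans (le_of_eq ?_)) _
        rw [hC₀]
        push_cast
        rfl
    _ = _ := by push_cast; ring
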